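/- Let $M$ be a convex globally hyperbolic maximal (CGHM) de Sitter manifold with particles, that is: a connected, oriented and time-oriented Lorentzian $3$-dimensional cone-manifold in which every point has a neighbourhood isometric to an open subset of de Sitter space $dS_3$ (regular points), or of the space $dS_\theta$ with metric $-dt^2+\cosh^2(t)\,(d\varphi^2+\sin^2(\varphi)\,d\alpha^2)$, $t\in\mathbb{R}$, $\varphi\in[0,\pi]$, $\alpha\in\mathbb{R}/\theta\mathbb{Z}$, with $\theta\in(0,\pi)$ (singular points, corresponding to $\varphi\in\{0,\pi\}$); $M$ is homeomorphic to $\Sigma\times\mathbb{R}$ for a closed surface $\Sigma$, with singular locus $\{p_1,\dots,p_n\}\times\mathbb{R}$ and constant cone angle $\theta_i\in(0,\pi)$ along $\{p_i\}\times\mathbb{R}$; $M$ contains a Cauchy surface, i.e. a strictly future-convex space-like surface orthogonal to the singular lines which meets every inextensible causal curve exactly once; and every isometric embedding of $M$ into another de Sitter manifold with particles which sends a Cauchy surface to a Cauchy surface is onto. For a space-like surface $S\subset M$, smooth away from the singular lines, let $I$ be the induced metric, $\eta$ the future-directed unit normal field and $B(v)=-\nabla_v\eta$ the shape operator at the regular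 points of $S$. The eigenvalues of $B$ are the principal curvatures, $H=\tfrac12\operatorname{tr}B$ is the mean curvature, and $S$ is called future-convex if its principal curvatures at regular points are non-positive (strictly future-convex if they are negative). The surface $S$ is orthogonal to a singular line at a point $p$ of it if $d(q,P)/d_S(p,q)\to 0$ as $q\to p$ in $S$, where $P$ is the totally geodesic plane orthogonal to the line at $p$, $d$ is the causal distance and $d_S$ the distance of $S$. The normal flow $\psi^t$ of $S$ sends a regular point $x$ of $S$ to the point at time $t$ of the geodesic with initial point $x$ and initial velocity $\eta(x)$. Let $K<0$ and let $\Sigma_K\subset M$ be a future-convex embedded space-like surface, orthogonal to the singular lines, whose induced metric has constant Gauss curvature $K$ at the regular points. Put $$\delta(K)=\operatorname{artanh}\left(\sqrt{\frac{1}{1-K}}\right),\qquad \xi(K)=\frac{K-2}{2\sqrt{1-K}},$$ and let $\psi^t$, $0\le t\le\delta(K)$, be the normal flow of the regular part of $\Sigma_K$ in the regular part of $M$. Then the parallel surface $\psi^{\delta(K)}(\Sigma_K)$ in the future of $\Sigma_K$ has constant mean curvature $\xi(K)$: near every regular point of $\Sigma_K$ the map $\psi^{\delta(K)}$ is a smooth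 embedding onto a space-like surface, whose mean curvature is equal to $\xi(K)$. -/

import Mathlib

open Set Filter Topology

noncomputable section

namespace DeSitter

/-! ### De Sitter space -/

/-- The vector space underlying `ℝ^{3,1}`. -/
abbrev V4 : Type := Fin 4 → ℝ

/-- The bilinear form of signature `(3,1)`. -/
def form (x y : V4) : ℝ := -(x 0 * y 0) + x 1 * y 1 + x 2 * y 2 + x 3 * y 3

/-- De Sitter space `dS₃`, the unit pseudo-sphere of `ℝ^{3,1}`. -/
def DS : Type := {x : V4 // form x x = 1}

instance : TopologicalSpace DS := inferInstanceAs (TopologicalSpace {x : V4 // form x x = 1})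

/-- The elements of `SO⁺(3,1)`, i.e. the isometries of `dS₃` preserving orientation and time
orientation. -/
def IsIsometryMatrix (A : Matrix (Fin 4) (Fin 4) ℝ) : Prop :=
  (∀ x y : V4, form (A.mulVec x) (A.mulVec y) = form x y) ∧ A.det = 1 ∧ 0 < A 0 0

/-- The projection of an ambient vector to the tangent space of `dS₃` at `x`. Composed with the
derivative of `ℝ⁴`, it is the Levi-Civita connection of `dS₃`. -/
def tangentProj (x v : V4) : V4 := v - form v x • x

/-- The causal relation of `dS₃` (time oriented so that `x 0` increases to the future). -/
def CausalLE (x y : DS) : Prop := x.1 0 ≤ y.1 0 ∧ 1 ≤ form x.1 y.1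

/-! ### De Sitter space with a cone singularity of angle `θ` -/

/-- In `ℝ × [0,π] × ℝ/θℤ`, the circles over `φ = 0` and over `φ = π` are collapsed to points. -/
def coneSetoid (θ : ℝ) : Setoid (ℝ × Icc (0 : ℝ) Real.pi × AddCircle θ) where
  r p q := p.1 = q.1 ∧ p.2.1 = q.2.1 ∧
    ((p.2.1 : ℝ) = 0 ∨ (p.2.1 : ℝ) = Real.pi ∨ p.2.2 = q.2.2)
  iseqv := by
    refine ⟨fun p => ⟨rfl, rfl, Or.inr (Or.inr rfl)⟩, ?_, ?_⟩
    · rintro p q ⟨h1, h2, h3⟩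
      refine ⟨h1.symm, h2.symm, ?_⟩
      rw [← h2]
      exact h3.imp id (Or.imp id Eq.symm)
    · rintro p q r ⟨h1, h2, h3⟩ ⟨k1, k2, k3⟩
      refine ⟨h1.trans k1, h2.trans k2, ?_⟩
      rw [← h2] at k3
      rcases h3 with h | h | h
      · exact Or.inl h
      · exact Or.inr (Or.inl h)
      · exact k3.imp id (Or.imp id h.trans)

/-- The space `dS_θ`, with its quotient topology. -/
def ConeDS (θ : ℝ) : Type := Quotient (coneSetoid θ)

instance (θ : ℝ) : TopologicalSpace (ConeDS θ) :=
  inferInstanceAs (TopologicalSpace (Quotient (coneSetoid θ)))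

/-- The point of `dS_θ` with coordinates `(t, φ, α)`; only used for `0 ≤ φ ≤ π`. -/
def conePoint (θ t φ α : ℝ) : ConeDS θ :=
  Quotient.mk (coneSetoid θ) (t, projIcc 0 Real.pi Real.pi_nonneg φ, (α : AddCircle θ))

/-- The coordinates `(t, φ, α)` of `dS₃`. The metric of the regular part of `dS_θ` is the pull-back
of that of `dS₃` under this map. -/
def dev (t φ α : ℝ) : V4 :=
  ![Real.sinh t, Real.cosh t * Real.sin φ * Real.cos α,
    Real.cosh t * Real.sin φ * Real.sin α, Real.cosh t * Real.cos φ]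

/-- The causal relation of `dS_θ`. The norm of `ℝ/θℤ` is the distance to `0`, so that two points
are related as the points of `dS₃` with the same `t`, `φ` and the same angle between them. -/
def ConeCausalLE (θ : ℝ) (p q : ConeDS θ) : Prop :=
  ∃ t φ α t' φ' α' : ℝ, φ ∈ Icc 0 Real.pi ∧ φ' ∈ Icc 0 Real.pi ∧
    p = conePoint θ t φ α ∧ q = conePoint θ t' φ' α' ∧ t ≤ t' ∧
    1 ≤ form (dev t φ 0) (dev t' φ' ‖((α' - α : ℝ) : AddCircle θ)‖)

/-- The squared norm of the coordinate velocity `(t', φ', α')` at `(t, φ, α)` for the metric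
`-dt² + cosh² t (dφ² + sin² φ dα²)` of `dS_θ`. -/
def coneQuad (t φ t' φ' α' : ℝ) : ℝ :=
  -t' ^ 2 + Real.cosh t ^ 2 * (φ' ^ 2 + Real.sin φ ^ 2 * α' ^ 2)

/-- `IsConePath θ S t₀ φ₀ q t φ α`: the curve `s ↦ (t s, φ s, α s)`, `0 < s ≤ 1`, is a `C¹` curve in
the regular part of `S ⊆ dS_θ` which issues from the point `(t₀, φ₀)` of the singular line
and ends at `q`. -/
structure IsConePath (θ : ℝ) (S : Set (ConeDS θ)) (t₀ φ₀ : ℝ) (q : ConeDS θ)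
    (t φ α : ℝ → ℝ) : Prop where
  smooth_t : ContDiffOn ℝ 1 t (Ioc 0 1)
  smooth_φ : ContDiffOn ℝ 1 φ (Ioc 0 1)
  smooth_α : ContDiffOn ℝ 1 α (Ioc 0 1)
  regular : ∀ s ∈ Ioc (0 : ℝ) 1, φ s ∈ Ioo 0 Real.pi
  mem : ∀ s ∈ Ioc (0 : ℝ) 1, conePoint θ (t s) (φ s) (α s) ∈ S
  start_t : Tendsto t (𝓝[>] 0) (𝓝 t₀)
  start_φ : Tendsto φ (𝓝[>] 0) (𝓝 φ₀)
  finish : conePoint θ (t 1) (φ 1) (α 1) = q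

/-- The length of a coordinate curve for the metric of `dS_θ`. -/
def conePathLength (t φ α : ℝ → ℝ) : ENNReal :=
  ∫⁻ s in Ioo (0 : ℝ) 1,
    ENNReal.ofReal (Real.sqrt (coneQuad (t s) (φ s) (deriv t s) (deriv φ s) (deriv α s)))

/-- The causal distance from the point `(t, φ, α)` to the totally geodesic plane orthogonal to the
singular line at the point `(t₀, φ₀)`, `φ₀ ∈ {0, π}`. The plane is `⟨x, ν⟩ = 0` with
`ν = (cosh t₀, 0, 0, sinh t₀ cos φ₀)`, and the distance is `arsinh |⟨x, ν⟩|`. -/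
def distToPlane (t₀ φ₀ t φ : ℝ) : ℝ :=
  Real.arsinh |Real.sinh t * Real.cosh t₀ -
    Real.cosh t * Real.cos φ * (Real.sinh t₀ * Real.cos φ₀)|

/-- Orthogonality of `S ⊆ dS_θ` to the singular line at its point `(t₀, φ₀)`: the ratio of
`d(q, P)` and `d_S(p, q)` tends to `0` as `q ∈ S` tends to `p`. As `d_S(p, q)` is the infimum of
the lengths of the paths in `S` from `p` to `q`, this is a bound for all these paths. -/
def ConeOrthogonalAt (θ : ℝ) (S : Set (ConeDS θ)) (t₀ φ₀ : ℝ) : Prop :=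
  ∀ ε : ℝ, 0 < ε → ∀ᶠ q in 𝓝 (conePoint θ t₀ φ₀ 0), q ∈ S →
    ∀ t φ α : ℝ → ℝ, IsConePath θ S t₀ φ₀ q t φ α →
      ENNReal.ofReal (distToPlane t₀ φ₀ (t 1) (φ 1)) ≤
        ENNReal.ofReal ε * conePathLength t φ α

/-! ### Local differential geometry of space-like surfaces in `dS₃` -/

/-- The parameter plane. -/
abbrev E2 : Type := Fin 2 → ℝ

/-- Partial derivatives. -/
def pd {W : Type*} [NormedAddCommGroup W] [NormedSpace ℝ W] (i : Fin 2) (f : E2 → W) (u : E2) : W :=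
  fderiv ℝ f u (Pi.single i 1)

/-- The first fundamental form of a parametrized surface `f` in the coordinate frame. -/
def firstForm (f : E2 → V4) (u : E2) : Matrix (Fin 2) (Fin 2) ℝ :=
  Matrix.of fun i j => form (pd i f u) (pd j f u)

/-- Christoffel symbols `Γ^k_{ij}` of a metric `g` on a domain of the plane. -/
def christoffel (g : E2 → Matrix (Fin 2) (Fin 2) ℝ) (k i j : Fin 2) (u : E2) : ℝ :=
  (1 / 2) * ∑ l, (g u)⁻¹ k l *
    (pd i (fun v => g v j l) u + pd j (fun v => g v i l) u - pd l (fun v => g v i j) u)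

/-- The `l`-th component of `R(∂₀, ∂₁)∂₁ = ∇₀∇₁∂₁ - ∇₁∇₀∂₁`. -/
def curvatureComp (g : E2 → Matrix (Fin 2) (Fin 2) ℝ) (l : Fin 2) (u : E2) : ℝ :=
  pd 0 (christoffel g l 1 1) u - pd 1 (christoffel g l 0 1) u +
    ∑ m, (christoffel g m 1 1 u * christoffel g l 0 m u -
      christoffel g m 0 1 u * christoffel g l 1 m u)

/-- The Gauss curvature `g(R(∂₀, ∂₁)∂₁, ∂₀) / det g` of a metric `g` on a domain of the plane. -/
def gaussCurvature (g : E2 → Matrix (Fin 2) (Fin 2) ℝ) (u : E2) : ℝ :=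
  (∑ l, g u 0 l * curvatureComp g l u) / (g u).det

/-- `n` is the future-directed unit normal at `u` of the surface `f` in `dS₃`. -/
def IsFutureUnitNormal (f : E2 → V4) (u : E2) (n : V4) : Prop :=
  form n (f u) = 0 ∧ (∀ i, form n (pd i f u) = 0) ∧ form n n = -1 ∧ 0 < n 0

open Classical in
/-- The future-directed unit normal field (it exists and is unique where `f` is space-like). -/
def unitNormal (f : E2 → V4) (u : E2) : V4 :=
  if h : ∃ n, IsFutureUnitNormal f u n then h.choose else 0

/-- `B` is the matrix, in the coordinate frame, of the shape operator `v ↦ -∇_v η` at `u`. -/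
def IsShapeOperator (f : E2 → V4) (u : E2) (B : Matrix (Fin 2) (Fin 2) ℝ) : Prop :=
  ∀ j, -tangentProj (f u) (pd j (unitNormal f) u) = ∑ i, B i j • pd i f u

/-- `lam` is a principal curvature of `f` at `u`. -/
def IsPrincipalCurvature (f : E2 → V4) (u : E2) (lam : ℝ) : Prop :=
  ∃ B, IsShapeOperator f u B ∧ Module.End.HasEigenvalue (Matrix.toLin' B) lam

/-- The surface `f` has mean curvature `tr B / 2 = H` at `u`. -/
def HasMeanCurvatureAt (f : E2 → V4) (u : E2) (H : ℝ) : Prop :=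
  ∃ B, IsShapeOperator f u B ∧ B.trace / 2 = H

/-! ### De Sitter manifolds with particles -/

universe u

/-- `e` is an isometry from an open subset of a space with an atlas `charts` of charts in `dS₃`
onto an open subset of `dS_θ`, the points outside all the charts corresponding to the
singular lines. -/
structure IsConeChart {M : Type u} [TopologicalSpace M]
    (charts : Set (OpenPartialHomeomorph M DS)) (θ : ℝ)
    (e : OpenPartialHomeomorph M (ConeDS θ)) : Prop where
  singular : ∀ t φ α : ℝ, (φ = 0 ∨ φ = Real.pi) → conePoint θ t φ α ∈ e.target →
    ∀ c ∈ charts, e.symm (conePoint θ t φ α) ∉ c.source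
  regular : ∀ t φ α : ℝ, φ ∈ Ioo 0 Real.pi → conePoint θ t φ α ∈ e.target →
    ∃ c ∈ charts, e.symm (conePoint θ t φ α) ∈ c.source
  isometric : ∀ t φ α : ℝ, φ ∈ Ioo 0 Real.pi → conePoint θ t φ α ∈ e.target →
    ∀ c ∈ charts, e.symm (conePoint θ t φ α) ∈ c.source →
      ∃ A, IsIsometryMatrix A ∧ ∀ᶠ q : ℝ × ℝ × ℝ in 𝓝 (t, φ, α),
        (c (e.symm (conePoint θ q.1 q.2.1 q.2.2))).1 = A.mulVec (dev q.1 q.2.1 q.2.2)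

/-- An oriented and time-oriented Lorentzian cone-manifold locally modelled on the spaces `dS_θ`,
with cone angles in `(0, π)` at the singular points. It is given by the isometric charts, with
values in `dS₃`, of its regular part. -/
structure ParticleManifold (M : Type u) [TopologicalSpace M] where
  charts : Set (OpenPartialHomeomorph M DS)
  compatible : ∀ c ∈ charts, ∀ c' ∈ charts, ∀ x ∈ c.source ∩ c'.source,
    ∃ A, IsIsometryMatrix A ∧ ∀ᶠ y in 𝓝 x, (c' y).1 = A.mulVec (c y).1
  cone : ∀ x, (∃ c ∈ charts, x ∈ c.source) ∨
    ∃ θ ∈ Ioo 0 Real.pi, ∃ e : OpenPartialHomeomorph M (ConeDS θ),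
      IsConeChart charts θ e ∧ x ∈ e.source

namespace ParticleManifold

variable {M : Type u} [TopologicalSpace M]

/-- The set of regular points. -/
def reg (X : ParticleManifold M) : Set M := {x | ∃ c ∈ X.charts, x ∈ c.source}

/-- The singular locus. -/
def sing (X : ParticleManifold M) : Set M := X.regᶜ

/-- A map to `M`, read in a chart with values in `dS₃ ⊆ ℝ⁴`. -/
def read {A : Type*} (c : OpenPartialHomeomorph M DS) (σ : A → M) : A → V4 := fun u => (c (σ u)).1

/-- `σ` maps the open set `U` of the plane into the domain of the chart `c`, as a smooth embedded
space-like surface. -/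
structure IsSpacelikePatch (X : ParticleManifold M) (c : OpenPartialHomeomorph M DS) (U : Set E2)
    (σ : E2 → M) : Prop where
  chart : c ∈ X.charts
  isOpen : IsOpen U
  mapsTo : MapsTo σ U c.source
  smooth : ContDiffOn ℝ (⊤ : ℕ∞) (read c σ) U
  spacelike : ∀ u ∈ U, (firstForm (read c σ) u).PosDef
  embedding : IsEmbedding (fun v : U => σ v)

/-- A local parametrization of (an open piece of the regular part of) `S`. -/
structure IsPatchOf (X : ParticleManifold M) (S : Set M) (c : OpenPartialHomeomorph M DS)
    (U : Set E2) (σ : E2 → M) : Prop extends X.IsSpacelikePatch c U σ where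
  image : ∃ O : Set M, IsOpen O ∧ σ '' U = S ∩ O

/-- An embedded space-like surface: a topological surface in `M`, which meets the singular locus in
isolated points and is smooth and space-like at its regular points. -/
structure IsSpacelikeSurface (X : ParticleManifold M) (S : Set M) : Prop where
  surface : ∀ x : S, ∃ e : OpenPartialHomeomorph S E2, x ∈ e.source
  isolated : ∀ x ∈ S ∩ X.sing, ∀ᶠ y in 𝓝[≠] x, y ∈ S → y ∈ X.reg
  patch : ∀ x ∈ S ∩ X.reg, ∃ c U σ, X.IsPatchOf S c U σ ∧ x ∈ σ '' U

/-- `S` is orthogonal to the singular lines. -/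
def IsOrthogonal (X : ParticleManifold M) (S : Set M) : Prop :=
  ∀ x ∈ S ∩ X.sing, ∃ θ ∈ Ioo 0 Real.pi, ∃ e : OpenPartialHomeomorph M (ConeDS θ),
    IsConeChart X.charts θ e ∧ x ∈ e.source ∧
    ∃ t₀ φ₀ : ℝ, (φ₀ = 0 ∨ φ₀ = Real.pi) ∧ e x = conePoint θ t₀ φ₀ 0 ∧
      ConeOrthogonalAt θ (e '' (S ∩ e.source)) t₀ φ₀

/-- `S` is future-convex: its principal curvatures are nowhere positive. -/
def IsFutureConvex (X : ParticleManifold M) (S : Set M) : Prop :=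
  ∀ c U σ, X.IsPatchOf S c U σ → ∀ u ∈ U, ∀ lam, IsPrincipalCurvature (read c σ) u lam → lam ≤ 0

/-- `S` is strictly future-convex: its principal curvatures are negative. -/
def IsStrictlyFutureConvex (X : ParticleManifold M) (S : Set M) : Prop :=
  ∀ c U σ, X.IsPatchOf S c U σ → ∀ u ∈ U, ∀ lam, IsPrincipalCurvature (read c σ) u lam → lam < 0

/-- The induced metric of the regular part of `S` has constant Gauss curvature `K`. -/
def HasConstantGaussCurvature (X : ParticleManifold M) (S : Set M) (K : ℝ) : Prop :=
  ∀ c U σ, X.IsPatchOf S c U σ → ∀ u ∈ U, gaussCurvature (firstForm (read c σ)) u = K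

/-- Future-directed causal curves, possibly through singular points. -/
def IsCausalCurve (X : ParticleManifold M) (γ : ℝ → M) : Prop :=
  Continuous γ ∧ ∀ s,
    (∃ c ∈ X.charts, γ s ∈ c.source ∧ ∃ ε > 0, ∀ s₁ ∈ Ioo (s - ε) (s + ε),
      ∀ s₂ ∈ Ioo (s - ε) (s + ε), s₁ < s₂ → γ s₁ ∈ c.source ∧ γ s₂ ∈ c.source ∧
        γ s₁ ≠ γ s₂ ∧ CausalLE (c (γ s₁)) (c (γ s₂))) ∨
    (∃ θ ∈ Ioo 0 Real.pi, ∃ e : OpenPartialHomeomorph M (ConeDS θ), IsConeChart X.charts θ e ∧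
      γ s ∈ e.source ∧ ∃ ε > 0, ∀ s₁ ∈ Ioo (s - ε) (s + ε),
      ∀ s₂ ∈ Ioo (s - ε) (s + ε), s₁ < s₂ → γ s₁ ∈ e.source ∧ γ s₂ ∈ e.source ∧
        γ s₁ ≠ γ s₂ ∧ ConeCausalLE θ (e (γ s₁)) (e (γ s₂)))

/-- Inextensible causal curves, parametrized by `ℝ`. -/
def IsInextensibleCausalCurve (X : ParticleManifold M) (γ : ℝ → M) : Prop :=
  X.IsCausalCurve γ ∧ (¬ ∃ x, Tendsto γ atTop (𝓝 x)) ∧ ¬ ∃ x, Tendsto γ atBot (𝓝 x)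

/-- Cauchy surfaces: strictly future-convex space-like surfaces, orthogonal to the singular locus,
that every inextensible causal curve meets exactly once. -/
structure IsCauchySurface (X : ParticleManifold M) (S : Set M) : Prop where
  surface : X.IsSpacelikeSurface S
  convex : X.IsStrictlyFutureConvex S
  orthogonal : X.IsOrthogonal S
  cauchy : ∀ γ, X.IsInextensibleCausalCurve γ → ∃! s, γ s ∈ S

/-- Isometric embeddings. -/
structure IsIsometricEmbedding (X : ParticleManifold M) {N : Type u} [TopologicalSpace N]
    (Y : ParticleManifold N) (F : M → N) : Prop where
  isOpenEmbedding : IsOpenEmbedding F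
  regular : ∀ x, F x ∈ Y.reg ↔ x ∈ X.reg
  isometric : ∀ x, ∀ c ∈ X.charts, x ∈ c.source → ∀ c' ∈ Y.charts, F x ∈ c'.source →
    ∃ A, IsIsometryMatrix A ∧ ∀ᶠ y in 𝓝 x, (c' (F y)).1 = A.mulVec (c y).1

/-- Convex globally hyperbolic maximal (CGHM) de Sitter manifolds with particles. -/
structure IsCGHM (X : ParticleManifold M) : Prop where
  /-- `M` is homeomorphic to `F × ℝ` for a closed connected surface `F`, the singular locus being
  `P × ℝ` with `P` finite and constant cone angles `ang p ∈ (0, π)` along `{p} × ℝ`. -/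
  product : ∃ (F : Type u) (_ : TopologicalSpace F) (_ : ChartedSpace (EuclideanSpace ℝ (Fin 2)) F)
    (h : M ≃ₜ F × ℝ) (P : Finset F) (ang : F → ℝ),
    CompactSpace F ∧ T2Space F ∧ ConnectedSpace F ∧ (∀ x, x ∈ X.sing ↔ (h x).1 ∈ P) ∧
    ∀ x ∈ X.sing, ang (h x).1 ∈ Ioo 0 Real.pi ∧
      ∃ e : OpenPartialHomeomorph M (ConeDS (ang (h x).1)),
        IsConeChart X.charts (ang (h x).1) e ∧ x ∈ e.source
  hyperbolic : ∃ S, X.IsCauchySurface S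
  maximal : ∀ (N : Type u) [TopologicalSpace N] [T2Space N] [SecondCountableTopology N]
    [ConnectedSpace N] (Y : ParticleManifold N) (F : M → N), X.IsIsometricEmbedding Y F →
    (∃ S, X.IsCauchySurface S ∧ Y.IsCauchySurface (F '' S)) → Function.Surjective F

/-! ### The normal flow and the parallel surfaces -/

/-- `γ` is a geodesic of the regular part on the interval `I`: in the charts, the covariant
derivative of its velocity vanishes. -/
def IsGeodesicOn (X : ParticleManifold M) (γ : ℝ → M) (I : Set ℝ) : Prop :=
  ContinuousOn γ I ∧ MapsTo γ I X.reg ∧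
  ∀ s ∈ I, ∀ c ∈ X.charts, γ s ∈ c.source → ∃ vel acc : ℝ → V4, ∀ᶠ r in 𝓝[I] s,
    HasDerivWithinAt (read c γ) (vel r) I r ∧ HasDerivWithinAt vel (acc r) I r ∧
      tangentProj (read c γ r) (acc r) = 0

/-- `ψ` is, up to time `T`, the flow along the future-directed unit normal field of the regular part
of `S`: `t ↦ ψ t x` is the geodesic issued from `x` with the unit normal at `x` as velocity. -/
structure IsNormalFlow (X : ParticleManifold M) (S : Set M) (T : ℝ) (ψ : ℝ → M → M) : Prop where
  continuousOn : ContinuousOn (fun p : ℝ × M => ψ p.1 p.2) (Icc 0 T ×ˢ (S ∩ X.reg))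
  start : ∀ x ∈ S ∩ X.reg, ψ 0 x = x
  geodesic : ∀ x ∈ S ∩ X.reg, X.IsGeodesicOn (fun t => ψ t x) (Icc 0 T)
  normal : ∀ c U σ, X.IsPatchOf S c U σ → ∀ u ∈ U,
    HasDerivWithinAt (read c fun t => ψ t (σ u)) (unitNormal (read c σ) u) (Icc 0 T) 0

/-- The image of `S` under `F` is, near the image of each regular point of `S`, a smooth space-like
surface locally embedded by `F`, and its mean curvature is constantly equal to `H`. -/
def ImageHasConstantMeanCurvature (X : ParticleManifold M) (S : Set M) (F : M → M) (H : ℝ) : Prop :=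
  (∀ x ∈ S ∩ X.reg, F x ∈ X.reg) ∧
  ∀ c U σ, X.IsPatchOf S c U σ → ∀ u ∈ U, ∀ c' ∈ X.charts, F (σ u) ∈ c'.source →
    ∃ U' ⊆ U, u ∈ U' ∧ X.IsSpacelikePatch c' U' (F ∘ σ) ∧
      ∀ v ∈ U', HasMeanCurvatureAt (read c' (F ∘ σ)) v H

end ParticleManifold

end DeSitter

end

namespace DeSitter

/-! ### The Lorentzian form -/

/-! Near a regular point the surface reads in a chart as an immersion `f` into `dS₃ ⊆ ℝ^{3,1}` with
unit normal `η` and shape operator `B`. Since `η` is time-like, Gauss' equation is `K = 1 - det B`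
(`IsSurface.gaussCurvature_eq`), so `det B = 1 - K`, which is `coth² T` for `T = δ(K)`. The
unit-speed geodesic along `η` is `cosh t • f + sinh t • η` (`geodesic_eq`). By Weingarten's equation
its differential in the surface directions is `df ∘ (cosh t - sinh t B)`, and that of its normal
`sinh t • f + cosh t • η` is `df ∘ (sinh t - cosh t B)`. The parallel surface therefore has shape
operator `(cosh t - sinh t B)⁻¹ (cosh t B - sinh t)`. When `sinh² t det B = cosh² t`, both the
numerator and the denominator of its trace contain the factor `2 cosh² t - cosh t sinh t tr B`. It
cancels, and the mean curvature is `-(cosh² t + sinh² t) / (2 cosh t sinh t)` whatever `tr B` is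
(`IsSurface.hasMeanCurvatureAt_of_eqOn_parallel`). At `t = T` this is `ξ(K)`. Future-convexity gives
`tr B ≤ 0`, so that factor, which is the determinant of `cosh T - sinh T B`, is positive and the
flow map is an immersion. The flow may leave the initial chart. A connectedness argument on `[0, T]`
shows that in any chart it is still the explicit parallel surface up to an element of `SO⁺(3,1)`
(`ParticleManifold.IsNormalFlow.exists_flowMatches`), which changes neither metric nor shape
operator. -/

theorem form_comm (x y : V4) : form x y = form y x := by simp only [form]; ring

theorem form_add_left (x y z : V4) : form (x + y) z = form x z + form y z := by
  simp only [form, Pi.add_apply]; ring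

theorem form_add_right (x y z : V4) : form x (y + z) = form x y + form x z := by
  simp only [form, Pi.add_apply]; ring

theorem form_sub_left (x y z : V4) : form (x - y) z = form x z - form y z := by
  simp only [form, Pi.sub_apply]; ring

theorem form_smul_left (a : ℝ) (x y : V4) : form (a • x) y = a * form x y := by
  simp only [form, Pi.smul_apply, smul_eq_mul]; ring

theorem form_smul_right (a : ℝ) (x y : V4) : form x (a • y) = a * form x y := by
  simp only [form, Pi.smul_apply, smul_eq_mul]; ring

/-- The Lorentzian form as a continuous bilinear map. -/
noncomputable def formL : V4 →L[ℝ] V4 →L[ℝ] ℝ :=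
  (LinearMap.mk₂ ℝ form form_add_left form_smul_left form_add_right
    form_smul_right).toContinuousBilinearMap

@[simp] theorem formL_apply (x y : V4) : formL x y = form x y := rfl

/-- Four vectors with nondegenerate Gram matrix have trivial orthogonal complement. -/
theorem eq_zero_of_form_eq_zero {p a b n w : V4} (hp : form p p = 1) (hn : form n n = -1)
    (hpa : form p a = 0) (hpb : form p b = 0) (hnp : form n p = 0) (hna : form n a = 0)
    (hnb : form n b = 0) (hd : form a a * form b b - form a b * form b a ≠ 0)
    (wp : form w p = 0) (wa : form w a = 0) (wb : form w b = 0) (wn : form w n = 0) : w = 0 := by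
  let Q : Matrix (Fin 4) (Fin 4) ℝ := Matrix.of ![p, a, b, n]
  let J : Matrix (Fin 4) (Fin 4) ℝ := Matrix.diagonal ![-1, 1, 1, 1]
  have hQ (x : V4) : (Q * J).mulVec x = ![form x p, form x a, form x b, form x n] := by
    ext i
    fin_cases i <;>
      simp [Q, J, Matrix.mulVec, dotProduct, Fin.sum_univ_four, form] <;> ring
  -- The Gram matrix of the four vectors factors through `Q * J`, so its nonvanishing determinant
  -- makes `Q * J` invertible.
  have hG : Q * J * Q.transpose = !![1, 0, 0, 0; 0, form a a, form b a, 0;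
      0, form a b, form b b, 0; 0, 0, 0, -1] := by
    ext i j
    have h1 := congrFun (hQ (![p, a, b, n] j)) i
    have h2 : (Q * J * Q.transpose) i j = (Q * J).mulVec (![p, a, b, n] j) i := rfl
    rw [h2, h1]
    fin_cases i <;> fin_cases j <;>
      simp [hp, hn, hpa, hpb, hnp, hna, hnb, form_comm a p, form_comm b p, form_comm p n,
        form_comm a n, form_comm b n]
  have hdet : (Q * J).det ≠ 0 := by
    intro h0
    have h1 := congrArg Matrix.det hG
    rw [Matrix.det_mul, h0, zero_mul] at h1
    simp [Matrix.det_succ_row_zero, Fin.sum_univ_succ, Fin.succAbove] at h1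
    apply hd
    linarith
  apply Matrix.eq_zero_of_mulVec_eq_zero hdet
  rw [hQ, wp, wa, wb, wn]
  ext i
  fin_cases i <;> rfl

/-- Time-like vectors with negative product lie in the same time cone. -/
theorem future_of_form_neg {n m : V4} (hn : form n n < 0) (n0 : 0 < n 0) (hm : form m m < 0)
    (hnm : form n m < 0) : 0 < m 0 := by
  simp only [form] at *
  by_contra! hc
  -- Cauchy–Schwarz in the space-like coordinates, by Lagrange's identity; with both vectors
  -- time-like it bounds the spatial product by `|n 0 * m 0|`.
  have hlag : (n 1 * m 1 + n 2 * m 2 + n 3 * m 3) ^ 2 ≤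
      (n 1 ^ 2 + n 2 ^ 2 + n 3 ^ 2) * (m 1 ^ 2 + m 2 ^ 2 + m 3 ^ 2) := by
    nlinarith [sq_nonneg (n 1 * m 2 - n 2 * m 1), sq_nonneg (n 1 * m 3 - n 3 * m 1),
      sq_nonneg (n 2 * m 3 - n 3 * m 2)]
  have h1 : (n 1 ^ 2 + n 2 ^ 2 + n 3 ^ 2) * (m 1 ^ 2 + m 2 ^ 2 + m 3 ^ 2) ≤
      n 0 ^ 2 * m 0 ^ 2 :=
    mul_le_mul (by nlinarith) (by nlinarith) (by positivity) (by positivity)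
  have h2 : (n 1 * m 1 + n 2 * m 2 + n 3 * m 3) ^ 2 ≤ (n 0 * m 0) ^ 2 := by
    rw [mul_pow]; exact hlag.trans h1
  have h3 : n 0 * m 0 ≤ 0 := mul_nonpos_of_nonneg_of_nonpos n0.le hc
  have h5 := sq_le_sq.mp h2
  rw [abs_of_nonpos h3] at h5
  have h6 := neg_abs_le (n 1 * m 1 + n 2 * m 2 + n 3 * m 3)
  linarith

/-! ### Isometries and the cross product -/

theorem IsIsometryMatrix.form_mulVec {A : Matrix (Fin 4) (Fin 4) ℝ} (hA : IsIsometryMatrix A)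
    (x y : V4) : form (A.mulVec x) (A.mulVec y) = form x y := hA.1 x y

/-- The image of the first basis vector is future-directed because `0 < A 0 0`, and its product with
the image of `n` is `-n 0 < 0`, so both lie in the same cone. -/
theorem IsIsometryMatrix.future {A : Matrix (Fin 4) (Fin 4) ℝ} (hA : IsIsometryMatrix A)
    {n : V4} (hn : form n n < 0) (n0 : 0 < n 0) : 0 < A.mulVec n 0 := by
  have he (x : V4) : form (Pi.single 0 1) x = -x 0 := by simp [form]
  refine future_of_form_neg (n := A.mulVec (Pi.single 0 1)) ?_ ?_ ?_ ?_
  · rw [hA.form_mulVec, he]; simp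
  · simpa using hA.2.2
  · rwa [hA.form_mulVec]
  · rw [hA.form_mulVec, he]; linarith

theorem isIsometryMatrix_one : IsIsometryMatrix 1 := by
  refine ⟨fun x y => by simp, by simp, by simp⟩

theorem IsIsometryMatrix.mul {A B : Matrix (Fin 4) (Fin 4) ℝ} (hA : IsIsometryMatrix A)
    (hB : IsIsometryMatrix B) : IsIsometryMatrix (A * B) := by
  refine ⟨fun x y => ?_, by rw [Matrix.det_mul, hA.2.1, hB.2.1, one_mul], ?_⟩
  · rw [← Matrix.mulVec_mulVec, ← Matrix.mulVec_mulVec, hA.form_mulVec, hB.form_mulVec]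
  · have h1 : 0 < B.mulVec (Pi.single 0 1) 0 := by simpa using hB.2.2
    have h2 : form (B.mulVec (Pi.single 0 1)) (B.mulVec (Pi.single 0 1)) < 0 := by
      rw [hB.form_mulVec]; simp [form]
    have h3 := hA.future h2 h1
    rw [Matrix.mulVec_mulVec] at h3
    simpa using h3

/-- The Lorentzian cross product of three vectors. -/
def cross (p a b : V4) : V4 :=
  ![p 1 * (a 2 * b 3 - a 3 * b 2) - p 2 * (a 1 * b 3 - a 3 * b 1) + p 3 * (a 1 * b 2 - a 2 * b 1),
    p 0 * (a 2 * b 3 - a 3 * b 2) - p 2 * (a 0 * b 3 - a 3 * b 0) + p 3 * (a 0 * b 2 - a 2 * b 0),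
    -(p 0 * (a 1 * b 3 - a 3 * b 1) - p 1 * (a 0 * b 3 - a 3 * b 0) +
      p 3 * (a 0 * b 1 - a 1 * b 0)),
    p 0 * (a 1 * b 2 - a 2 * b 1) - p 1 * (a 0 * b 2 - a 2 * b 0) + p 2 * (a 0 * b 1 - a 1 * b 0)]

theorem form_cross_left (p a b : V4) : form (cross p a b) p = 0 := by
  simp [form, cross]; ring

theorem form_cross_middle (p a b : V4) : form (cross p a b) a = 0 := by
  simp [form, cross]; ring

theorem form_cross_right (p a b : V4) : form (cross p a b) b = 0 := by
  simp [form, cross]; ring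

/-- Up to sign this is the Gram determinant of the three vectors; the minus sign comes from the
signature. -/
theorem form_cross_self (p a b : V4) : form (cross p a b) (cross p a b) =
    -(form p p * (form a a * form b b - form a b ^ 2) -
      form p a * (form p a * form b b - form a b * form p b) +
      form p b * (form p a * form a b - form a a * form p b)) := by
  simp [form, cross]; ring

/-! ### Partial derivatives -/

section PartialDerivatives

variable {W : Type*} [NormedAddCommGroup W] [NormedSpace ℝ W]

theorem pd_congr {f g : E2 → W} {u : E2} (h : f =ᶠ[𝓝 u] g) (i : Fin 2) : pd i f u = pd i g u := by
  simp only [pd, h.fderiv_eq]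

theorem pd_const (i : Fin 2) (w : W) (u : E2) : pd i (fun _ => w) u = 0 := by
  simp [pd]

theorem pd_add {f g : E2 → W} {u : E2} (hf : DifferentiableAt ℝ f u) (hg : DifferentiableAt ℝ g u)
    (i : Fin 2) : pd i (fun v => f v + g v) u = pd i f u + pd i g u := by
  simp only [pd, fderiv_fun_add hf hg, add_apply]

theorem pd_sub {f g : E2 → W} {u : E2} (hf : DifferentiableAt ℝ f u) (hg : DifferentiableAt ℝ g u)
    (i : Fin 2) : pd i (fun v => f v - g v) u = pd i f u - pd i g u := by
  simp only [pd, fderiv_fun_sub hf hg, sub_apply]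

theorem pd_smul {a : E2 → ℝ} {f : E2 → W} {u : E2} (ha : DifferentiableAt ℝ a u)
    (hf : DifferentiableAt ℝ f u) (i : Fin 2) :
    pd i (fun v => a v • f v) u = a u • pd i f u + pd i a u • f u := by
  simp [pd, fderiv_fun_smul ha hf]

theorem pd_clm {W' : Type*} [NormedAddCommGroup W'] [NormedSpace ℝ W'] (A : W →L[ℝ] W')
    {f : E2 → W} {u : E2} (hf : DifferentiableAt ℝ f u) (i : Fin 2) :
    pd i (fun v => A (f v)) u = A (pd i f u) := by
  have := (A.hasFDerivAt.comp u hf.hasFDerivAt).fderiv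
  simp only [Function.comp_def] at this
  simp [pd, this]

theorem pd_form {a b : E2 → V4} {u : E2} (ha : DifferentiableAt ℝ a u)
    (hb : DifferentiableAt ℝ b u) (i : Fin 2) :
    pd i (fun v => form (a v) (b v)) u = form (a u) (pd i b u) + form (pd i a u) (b u) := by
  have := (formL.hasFDerivAt_of_bilinear ha.hasFDerivAt hb.hasFDerivAt).fderiv
  simp only [formL_apply] at this
  simp [pd, this]

theorem contDiffOn_pd {f : E2 → W} {U : Set E2} (hU : IsOpen U)
    (hf : ContDiffOn ℝ (⊤ : ℕ∞) f U) (i : Fin 2) : ContDiffOn ℝ (⊤ : ℕ∞) (pd i f) U :=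
  (hf.fderiv_of_isOpen hU (by simp)).clm_apply contDiffOn_const

theorem pd_comm {f : E2 → W} {u : E2} (hf : ContDiffAt ℝ (⊤ : ℕ∞) f u) (i j : Fin 2) :
    pd i (pd j f) u = pd j (pd i f) u := by
  have h2 : (2 : WithTop ℕ∞) ≤ ((⊤ : ℕ∞) : WithTop ℕ∞) := by
    exact WithTop.coe_le_coe.mpr (le_top : (2 : ℕ∞) ≤ ⊤)
  have hs := hf.isSymmSndFDerivAt (by simpa using h2)
  have hd : DifferentiableAt ℝ (fderiv ℝ f) u :=
    (hf.fderiv_right (m := 1) (by rwa [one_add_one_eq_two])).differentiableAt (by simp)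
  have key (i j : Fin 2) :
      pd i (pd j f) u = fderiv ℝ (fderiv ℝ f) u (Pi.single i 1) (Pi.single j 1) := by
    have h := fderiv_clm_apply hd (differentiableAt_const (Pi.single j (1 : ℝ) : E2))
    have h' : pd j f = fun v => fderiv ℝ f v (Pi.single j 1) := rfl
    rw [h', pd, h]
    simp
  rw [key, key, hs]

theorem contDiffOn_form {a b : E2 → V4} {U : Set E2} (ha : ContDiffOn ℝ (⊤ : ℕ∞) a U)
    (hb : ContDiffOn ℝ (⊤ : ℕ∞) b U) : ContDiffOn ℝ (⊤ : ℕ∞) (fun v => form (a v) (b v)) U :=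
  formL.isBoundedBilinearMap.contDiff.comp_contDiffOn (ha.prodMk hb)

end PartialDerivatives

/-! ### Space-like surfaces of `dS₃` -/

/-- A smooth space-like parametrized surface of `dS₃`. -/
structure IsSurface (f : E2 → V4) (U : Set E2) : Prop where
  isOpen : IsOpen U
  smooth : ContDiffOn ℝ (⊤ : ℕ∞) f U
  sphere : ∀ u ∈ U, form (f u) (f u) = 1
  spacelike : ∀ u ∈ U, (firstForm f u).PosDef

/-- The second fundamental form in the coordinate frame. -/
noncomputable def secondForm (f : E2 → V4) (u : E2) : Matrix (Fin 2) (Fin 2) ℝ :=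
  Matrix.of fun i j => form (pd i (pd j f) u) (unitNormal f u)

/-- The matrix of the shape operator in the coordinate frame. -/
noncomputable def shapeMatrix (f : E2 → V4) (u : E2) : Matrix (Fin 2) (Fin 2) ℝ :=
  (firstForm f u)⁻¹ * secondForm f u

theorem firstForm_apply (f : E2 → V4) (u : E2) (i j : Fin 2) :
    firstForm f u i j = form (pd i f u) (pd j f u) := rfl

theorem secondForm_apply (f : E2 → V4) (u : E2) (i j : Fin 2) :
    secondForm f u i j = form (pd i (pd j f) u) (unitNormal f u) := rfl

namespace IsSurface

variable {f : E2 → V4} {U : Set E2} {u : E2}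

theorem contDiffAt (hf : IsSurface f U) (hu : u ∈ U) : ContDiffAt ℝ (⊤ : ℕ∞) f u :=
  hf.smooth.contDiffAt (hf.isOpen.mem_nhds hu)

theorem contDiffOn_pd (hf : IsSurface f U) (i : Fin 2) : ContDiffOn ℝ (⊤ : ℕ∞) (pd i f) U :=
  DeSitter.contDiffOn_pd hf.isOpen hf.smooth i

theorem differentiableAt_of_contDiffOn {W : Type*} [NormedAddCommGroup W] [NormedSpace ℝ W]
    (hf : IsSurface f U) (hu : u ∈ U) {a : E2 → W}
    (ha : ContDiffOn ℝ (⊤ : ℕ∞) a U) : DifferentiableAt ℝ a u :=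
  (ha.contDiffAt (hf.isOpen.mem_nhds hu)).differentiableAt (by simp)

theorem det_pos (hf : IsSurface f U) (hu : u ∈ U) : 0 < (firstForm f u).det :=
  (hf.spacelike u hu).det_pos

theorem form_pd_self (hf : IsSurface f U) (hu : u ∈ U) (i : Fin 2) : form (f u) (pd i f u) = 0 := by
  have hd := hf.differentiableAt_of_contDiffOn hu hf.smooth
  have h1 := pd_form hd hd i
  have h2 : (fun v => form (f v) (f v)) =ᶠ[𝓝 u] fun _ => 1 := by
    filter_upwards [hf.isOpen.mem_nhds hu] with v hv using hf.sphere v hv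
  rw [pd_congr h2, pd_const, form_comm (pd i f u)] at h1
  linarith

/-- The determinant of the first form as the square of the norm of the cross product. -/
theorem form_cross (hf : IsSurface f U) (hu : u ∈ U) :
    form (cross (f u) (pd 0 f u) (pd 1 f u)) (cross (f u) (pd 0 f u) (pd 1 f u)) =
      -(firstForm f u).det := by
  rw [form_cross_self, hf.sphere u hu, hf.form_pd_self hu, hf.form_pd_self hu, Matrix.det_fin_two]
  simp only [firstForm_apply, form_comm (pd 1 f u) (pd 0 f u)]
  ring

/-- A time-like vector has nonzero time coordinate. This allows division by the root of its square,
which fixes the sign of the normal by a smooth formula. -/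
theorem cross_zero_sq_pos (hf : IsSurface f U) (hu : u ∈ U) :
    0 < cross (f u) (pd 0 f u) (pd 1 f u) 0 ^ 2 := by
  have h1 := hf.form_cross hu
  have h2 := hf.det_pos hu
  simp only [form] at h1
  nlinarith [sq_nonneg (cross (f u) (pd 0 f u) (pd 1 f u) 1),
    sq_nonneg (cross (f u) (pd 0 f u) (pd 1 f u) 2),
    sq_nonneg (cross (f u) (pd 0 f u) (pd 1 f u) 3)]

/-- The unit normal through the cross product, with the sign that makes it future-directed. -/
theorem isFutureUnitNormal_cross (hf : IsSurface f U) (hu : u ∈ U) :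
    IsFutureUnitNormal f u ((cross (f u) (pd 0 f u) (pd 1 f u) 0 /
      (√(cross (f u) (pd 0 f u) (pd 1 f u) 0 ^ 2) * √(firstForm f u).det)) •
        cross (f u) (pd 0 f u) (pd 1 f u)) := by
  have hd := hf.det_pos hu
  have hN := hf.form_cross hu
  have h0 := hf.cross_zero_sq_pos hu
  have e1 := form_cross_left (f u) (pd 0 f u) (pd 1 f u)
  have e2 := form_cross_middle (f u) (pd 0 f u) (pd 1 f u)
  have e3 := form_cross_right (f u) (pd 0 f u) (pd 1 f u)
  generalize cross (f u) (pd 0 f u) (pd 1 f u) = N at *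
  have hs := Real.sqrt_pos.mpr h0
  have hs' := Real.sq_sqrt h0.le
  have ht := Real.sqrt_pos.mpr hd
  have ht' := Real.sq_sqrt hd.le
  refine ⟨by rw [form_smul_left, e1, mul_zero], fun i => ?_, ?_, ?_⟩
  · fin_cases i
    · simp [form_smul_left, e2]
    · simp [form_smul_left, e3]
  · rw [form_smul_left, form_smul_right, hN]
    field_simp
    rw [ht', hs']
  · simp only [Pi.smul_apply, smul_eq_mul]
    rw [div_mul_eq_mul_div, ← sq]
    positivity

theorem unitNormal_spec (hf : IsSurface f U) (hu : u ∈ U) :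
    IsFutureUnitNormal f u (unitNormal f u) := by
  have h : ∃ n, IsFutureUnitNormal f u n := ⟨_, hf.isFutureUnitNormal_cross hu⟩
  rw [unitNormal, dif_pos h]
  exact h.choose_spec

theorem form_normal_self (hf : IsSurface f U) (hu : u ∈ U) :
    form (unitNormal f u) (unitNormal f u) = -1 := (hf.unitNormal_spec hu).2.2.1

theorem form_normal_position (hf : IsSurface f U) (hu : u ∈ U) :
    form (unitNormal f u) (f u) = 0 := (hf.unitNormal_spec hu).1

theorem form_normal_pd (hf : IsSurface f U) (hu : u ∈ U) (i : Fin 2) :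
    form (unitNormal f u) (pd i f u) = 0 := (hf.unitNormal_spec hu).2.1 i

/-- Stated for an arbitrary future unit normal, so that it can be used to compare two of them. -/
theorem eq_zero_of_orthogonal' (hf : IsSurface f U) (hu : u ∈ U) {n w : V4}
    (hn : IsFutureUnitNormal f u n) (h1 : form w (f u) = 0) (h2 : ∀ i, form w (pd i f u) = 0)
    (h3 : form w n = 0) : w = 0 := by
  refine eq_zero_of_form_eq_zero (hf.sphere u hu) hn.2.2.1 (hf.form_pd_self hu 0)
    (hf.form_pd_self hu 1) hn.1 (hn.2.1 0) (hn.2.1 1) ?_ h1 (h2 0) (h2 1) h3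
  have := (hf.det_pos hu).ne'
  rwa [Matrix.det_fin_two] at this

/-- The position vector, the coordinate frame and the normal span `ℝ^{3,1}`. -/
theorem eq_zero_of_orthogonal (hf : IsSurface f U) (hu : u ∈ U) {w : V4}
    (h1 : form w (f u) = 0) (h2 : ∀ i, form w (pd i f u) = 0)
    (h3 : form w (unitNormal f u) = 0) : w = 0 :=
  hf.eq_zero_of_orthogonal' hu (hf.unitNormal_spec hu) h1 h2 h3

/-- The part of `m` orthogonal to `n` is orthogonal to the whole frame, hence zero; so `m` is a
multiple of `n`, with factor `1` by norm and time orientation. Thus the chosen normal can be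
replaced by any explicit one. -/
theorem eq_unitNormal (hf : IsSurface f U) (hu : u ∈ U) {n : V4} (hn : IsFutureUnitNormal f u n) :
    unitNormal f u = n := by
  have hm := hf.unitNormal_spec hu
  generalize unitNormal f u = m at hm
  have h0 : m + form m n • n = 0 := by
    refine hf.eq_zero_of_orthogonal' hu hn ?_ (fun i => ?_) ?_
    · rw [form_add_left, form_smul_left, hm.1, hn.1]; ring
    · rw [form_add_left, form_smul_left, hm.2.1, hn.2.1]; ring
    · rw [form_add_left, form_smul_left, hn.2.2.1]; ring
  have h1 : m = (-form m n) • n := by rw [neg_smul]; exact eq_neg_of_add_eq_zero_left h0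
  have h2 := hm.2.2.1
  generalize -form m n = a at h1
  rw [h1, form_smul_left, form_smul_right, hn.2.2.1] at h2
  have h3 := hm.2.2.2
  rw [h1, Pi.smul_apply, smul_eq_mul] at h3
  have h4 : 0 < a := (pos_iff_pos_of_mul_pos h3).mpr hn.2.2.2
  have h5 : a = 1 := by nlinarith
  rw [h1, h5, one_smul]

theorem contDiffOn_det (hf : IsSurface f U) :
    ContDiffOn ℝ (⊤ : ℕ∞) (fun v => (firstForm f v).det) U := by
  simp only [Matrix.det_fin_two, firstForm_apply]
  have h (i j) := contDiffOn_form (hf.contDiffOn_pd i) (hf.contDiffOn_pd j)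
  exact ((h 0 0).mul (h 1 1)).sub ((h 0 1).mul (h 1 0))

theorem contDiffOn_unitNormal (hf : IsSurface f U) : ContDiffOn ℝ (⊤ : ℕ∞) (unitNormal f) U := by
  have hc : ContDiffOn ℝ (⊤ : ℕ∞) (fun v => cross (f v) (pd 0 f v) (pd 1 f v)) U := by
    have h := contDiffOn_pi.mp hf.smooth
    have h0 := contDiffOn_pi.mp (hf.contDiffOn_pd 0)
    have h1 := contDiffOn_pi.mp (hf.contDiffOn_pd 1)
    rw [contDiffOn_pi]
    intro i
    fin_cases i <;> simp [cross] <;> fun_prop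
  have h0 := contDiffOn_pi.mp hc 0
  have hs : ContDiffOn ℝ (⊤ : ℕ∞) (fun v => √(cross (f v) (pd 0 f v) (pd 1 f v) 0 ^ 2)) U :=
    (h0.pow 2).sqrt fun v hv => (hf.cross_zero_sq_pos hv).ne'
  have ht : ContDiffOn ℝ (⊤ : ℕ∞) (fun v => √(firstForm f v).det) U :=
    hf.contDiffOn_det.sqrt fun v hv => (hf.det_pos hv).ne'
  refine ((h0.div (hs.mul ht) fun v hv => ?_).smul hc).congr fun v hv =>
    hf.eq_unitNormal hv (hf.isFutureUnitNormal_cross hv)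
  have := Real.sqrt_pos.mpr (hf.cross_zero_sq_pos hv)
  have := Real.sqrt_pos.mpr (hf.det_pos hv)
  positivity

theorem contDiffOn_inv (hf : IsSurface f U) (k l : Fin 2) :
    ContDiffOn ℝ (⊤ : ℕ∞) (fun v => (firstForm f v)⁻¹ k l) U := by
  have hi : ContDiffOn ℝ (⊤ : ℕ∞) (fun v => ((firstForm f v).det)⁻¹) U :=
    hf.contDiffOn_det.inv fun v hv => (hf.det_pos hv).ne'
  have h (i j) := contDiffOn_form (hf.contDiffOn_pd i) (hf.contDiffOn_pd j)
  simp only [Matrix.inv_def, Matrix.adjugate_fin_two, Ring.inverse_eq_inv', Matrix.smul_apply,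
    smul_eq_mul, firstForm_apply]
  refine hi.mul ?_
  fin_cases k <;> fin_cases l <;> simp
  exacts [h 1 1, (h 0 1).neg, (h 1 0).neg, h 0 0]

/-! ### The equations of Gauss and Weingarten -/

theorem differentiableAt_pd (hf : IsSurface f U) (hu : u ∈ U) (i : Fin 2) :
    DifferentiableAt ℝ (pd i f) u := hf.differentiableAt_of_contDiffOn hu (hf.contDiffOn_pd i)

theorem differentiableAt_unitNormal (hf : IsSurface f U) (hu : u ∈ U) :
    DifferentiableAt ℝ (unitNormal f) u :=
  hf.differentiableAt_of_contDiffOn hu hf.contDiffOn_unitNormal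

theorem secondForm_symm (hf : IsSurface f U) (hu : u ∈ U) (i j : Fin 2) :
    secondForm f u i j = secondForm f u j i := by
  rw [secondForm_apply, secondForm_apply, pd_comm (hf.contDiffAt hu)]

theorem form_pd_normal_self (hf : IsSurface f U) (hu : u ∈ U) (i : Fin 2) :
    form (pd i (unitNormal f) u) (unitNormal f u) = 0 := by
  have hd := hf.differentiableAt_unitNormal hu
  have h1 := pd_form hd hd i
  have h2 : (fun v => form (unitNormal f v) (unitNormal f v)) =ᶠ[𝓝 u] fun _ => -1 := by
    filter_upwards [hf.isOpen.mem_nhds hu] with v hv using hf.form_normal_self hv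
  rw [pd_congr h2, pd_const, form_comm (unitNormal f u)] at h1
  linarith

theorem form_pd_normal_position (hf : IsSurface f U) (hu : u ∈ U) (i : Fin 2) :
    form (pd i (unitNormal f) u) (f u) = 0 := by
  have h1 := pd_form (hf.differentiableAt_unitNormal hu)
    (hf.differentiableAt_of_contDiffOn hu hf.smooth) i
  have h2 : (fun v => form (unitNormal f v) (f v)) =ᶠ[𝓝 u] fun _ => 0 := by
    filter_upwards [hf.isOpen.mem_nhds hu] with v hv using hf.form_normal_position hv
  rw [pd_congr h2, pd_const, hf.form_normal_pd hu] at h1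
  linarith

theorem form_pd_normal_pd (hf : IsSurface f U) (hu : u ∈ U) (i j : Fin 2) :
    form (pd i (unitNormal f) u) (pd j f u) = -secondForm f u i j := by
  have h1 := pd_form (hf.differentiableAt_unitNormal hu) (hf.differentiableAt_pd hu j) i
  have h2 : (fun v => form (unitNormal f v) (pd j f v)) =ᶠ[𝓝 u] fun _ => 0 := by
    filter_upwards [hf.isOpen.mem_nhds hu] with v hv using hf.form_normal_pd hv j
  rw [pd_congr h2, pd_const, form_comm] at h1
  rw [secondForm_apply]
  linarith

/-- Differentiate `⟨f, ∂_j f⟩ = 0`. This component along the position vector is the source of the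
ambient curvature `1` in Gauss' equation. -/
theorem form_pd_pd_position (hf : IsSurface f U) (hu : u ∈ U) (i j : Fin 2) :
    form (pd i (pd j f) u) (f u) = -firstForm f u i j := by
  have h1 := pd_form (hf.differentiableAt_of_contDiffOn hu hf.smooth)
    (hf.differentiableAt_pd hu j) i
  have h2 : (fun v => form (f v) (pd j f v)) =ᶠ[𝓝 u] fun _ => 0 := by
    filter_upwards [hf.isOpen.mem_nhds hu] with v hv using hf.form_pd_self hv j
  rw [pd_congr h2, pd_const, form_comm] at h1
  rw [firstForm_apply]
  linarith

theorem firstForm_mul_shapeMatrix (hf : IsSurface f U) (hu : u ∈ U) :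
    firstForm f u * shapeMatrix f u = secondForm f u :=
  Matrix.mul_nonsing_inv_cancel_left _ _ (hf.det_pos hu).ne'.isUnit

/-- Weingarten's equation. -/
theorem pd_unitNormal (hf : IsSurface f U) (hu : u ∈ U) (j : Fin 2) :
    pd j (unitNormal f) u = -∑ i, shapeMatrix f u i j • pd i f u := by
  rw [Fin.sum_univ_two]
  refine eq_neg_of_add_eq_zero_left (hf.eq_zero_of_orthogonal hu ?_ (fun l => ?_) ?_)
  · simp only [form_add_left, form_smul_left, hf.form_pd_normal_position hu,
      form_comm (pd _ f u) (f u), hf.form_pd_self hu]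
    ring
  · have h := congrFun (congrFun (hf.firstForm_mul_shapeMatrix hu) l) j
    rw [Matrix.mul_apply, Fin.sum_univ_two, firstForm_apply, firstForm_apply,
      hf.secondForm_symm hu] at h
    simp only [form_add_left, form_smul_left, hf.form_pd_normal_pd hu, ← h,
      form_comm (pd l f u)]
    ring
  · simp only [form_add_left, form_smul_left, hf.form_pd_normal_self hu,
      form_comm (pd _ f u) (unitNormal f u), hf.form_normal_pd hu]
    ring

theorem isShapeOperator (hf : IsSurface f U) (hu : u ∈ U) :
    IsShapeOperator f u (shapeMatrix f u) := by
  intro j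
  rw [tangentProj, hf.form_pd_normal_position hu, hf.pd_unitNormal hu]
  simp

/-- Koszul's formula: expanding the derivatives of the metric, all terms cancel by symmetry of
second derivatives except twice the tangential part of `∂_i ∂_j f`. -/
theorem christoffel_eq (hf : IsSurface f U) (hu : u ∈ U) (k i j : Fin 2) :
    christoffel (firstForm f) k i j u =
      ∑ l, (firstForm f u)⁻¹ k l * form (pd i (pd j f) u) (pd l f u) := by
  have h (i j l : Fin 2) : pd i (fun v => firstForm f v j l) u =
      form (pd j f u) (pd i (pd l f) u) + form (pd i (pd j f) u) (pd l f u) :=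
    pd_form (hf.differentiableAt_pd hu j) (hf.differentiableAt_pd hu l) i
  have hc := pd_comm (hf.contDiffAt hu)
  rw [christoffel, Finset.mul_sum]
  refine Finset.sum_congr rfl fun l _ => ?_
  rw [h, h, h, hc j i, hc l i, hc l j, form_comm (pd j f u) (pd i (pd l f) u)]
  ring

theorem contDiffOn_christoffel (hf : IsSurface f U) (k i j : Fin 2) :
    ContDiffOn ℝ (⊤ : ℕ∞) (christoffel (firstForm f) k i j) U := by
  refine ContDiffOn.congr ?_ fun v hv => hf.christoffel_eq hv k i j
  exact ContDiffOn.sum fun l _ => (hf.contDiffOn_inv k l).mul (contDiffOn_form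
    (DeSitter.contDiffOn_pd hf.isOpen (hf.contDiffOn_pd j) i) (hf.contDiffOn_pd l))

theorem sum_christoffel_mul_firstForm (hf : IsSurface f U) (hu : u ∈ U) (i j l : Fin 2) :
    ∑ k, christoffel (firstForm f) k i j u * firstForm f u k l =
      form (pd i (pd j f) u) (pd l f u) := by
  have hg : firstForm f u * (firstForm f u)⁻¹ = 1 :=
    Matrix.mul_nonsing_inv _ (hf.det_pos hu).ne'.isUnit
  have hsymm (k : Fin 2) : firstForm f u k l = firstForm f u l k := form_comm _ _
  have h (m : Fin 2) := congrFun (congrFun hg l) m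
  simp only [Matrix.mul_apply, Fin.sum_univ_two] at h
  simp only [hf.christoffel_eq hu, Fin.sum_univ_two, hsymm]
  have h0 := h 0
  have h1 := h 1
  obtain rfl | rfl : l = 0 ∨ l = 1 := by omega
  all_goals
    simp only [Matrix.one_apply_eq, ne_eq, zero_ne_one, one_ne_zero, not_false_eq_true,
      Matrix.one_apply_ne] at h0 h1
    linear_combination form (pd i (pd j f) u) (pd 0 f u) * h0 +
      form (pd i (pd j f) u) (pd 1 f u) * h1

/-- Gauss' formula for the second derivatives of the parametrization. -/
theorem pd_pd (hf : IsSurface f U) (hu : u ∈ U) (i j : Fin 2) :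
    pd i (pd j f) u = christoffel (firstForm f) 0 i j u • pd 0 f u +
      christoffel (firstForm f) 1 i j u • pd 1 f u - firstForm f u i j • f u -
      secondForm f u i j • unitNormal f u := by
  refine eq_of_sub_eq_zero (hf.eq_zero_of_orthogonal hu ?_ (fun l => ?_) ?_)
  · simp only [form_sub_left, form_add_left, form_smul_left, hf.form_pd_pd_position hu,
      form_comm (pd _ f u) (f u), hf.form_pd_self hu, hf.sphere u hu, hf.form_normal_position hu]
    ring
  · have h := hf.sum_christoffel_mul_firstForm hu i j l
    rw [Fin.sum_univ_two, firstForm_apply f u 0 l, firstForm_apply f u 1 l] at h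
    simp only [form_sub_left, form_add_left, form_smul_left, hf.form_pd_self hu,
      hf.form_normal_pd hu, ← h]
    ring
  · simp only [form_sub_left, form_add_left, form_smul_left, hf.form_normal_self hu,
      form_comm (pd _ f u) (unitNormal f u), hf.form_normal_pd hu,
      form_comm (f u) (unitNormal f u), hf.form_normal_position hu, ← secondForm_apply]
    ring

/-- Differentiate Gauss' formula and pair with `∂_l f`. The terms in `f` and `η` themselves vanish;
their derivatives leave the two products of fundamental forms, the second with a plus sign since
`⟨∂_m η, ∂_l f⟩ = -h_{ml}`. -/
theorem form_pd_pd_pd (hf : IsSurface f U) (hu : u ∈ U) (m i j l : Fin 2) :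
    form (pd m (pd i (pd j f)) u) (pd l f u) =
      ∑ k, (pd m (christoffel (firstForm f) k i j) u * firstForm f u k l +
        christoffel (firstForm f) k i j u * form (pd m (pd k f) u) (pd l f u)) -
      firstForm f u i j * firstForm f u m l + secondForm f u i j * secondForm f u m l := by
  have he : pd i (pd j f) =ᶠ[𝓝 u] fun v => christoffel (firstForm f) 0 i j v • pd 0 f v +
      christoffel (firstForm f) 1 i j v • pd 1 f v - firstForm f v i j • f v -
      secondForm f v i j • unitNormal f v := by
    filter_upwards [hf.isOpen.mem_nhds hu] with v hv using hf.pd_pd hv i j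
  have dΓ (k) := hf.differentiableAt_of_contDiffOn hu (hf.contDiffOn_christoffel k i j)
  have df := hf.differentiableAt_of_contDiffOn hu hf.smooth
  have dη := hf.differentiableAt_unitNormal hu
  have dg : DifferentiableAt ℝ (fun v => firstForm f v i j) u :=
    hf.differentiableAt_of_contDiffOn hu
      (contDiffOn_form (hf.contDiffOn_pd i) (hf.contDiffOn_pd j))
  have dh : DifferentiableAt ℝ (fun v => secondForm f v i j) u :=
    hf.differentiableAt_of_contDiffOn hu (contDiffOn_form
      (DeSitter.contDiffOn_pd hf.isOpen (hf.contDiffOn_pd j) i) hf.contDiffOn_unitNormal)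
  have d0 := (dΓ 0).fun_smul (hf.differentiableAt_pd hu 0)
  have d1 := (dΓ 1).fun_smul (hf.differentiableAt_pd hu 1)
  rw [pd_congr he, pd_sub ((d0.fun_add d1).fun_sub (dg.fun_smul df)) (dh.fun_smul dη),
    pd_sub (d0.fun_add d1) (dg.fun_smul df), pd_add d0 d1, pd_smul (dΓ 0) (hf.differentiableAt_pd hu 0),
    pd_smul (dΓ 1) (hf.differentiableAt_pd hu 1), pd_smul dg df, pd_smul dh dη]
  simp only [form_sub_left, form_add_left, form_smul_left, hf.form_pd_self hu,
    hf.form_normal_pd hu, hf.form_pd_normal_pd hu, ← firstForm_apply, Fin.sum_univ_two]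
  ring

/-- Gauss' equation for space-like surfaces in `dS₃`. -/
theorem gaussCurvature_eq (hf : IsSurface f U) (hu : u ∈ U) :
    gaussCurvature (firstForm f) u = 1 - (shapeMatrix f u).det := by
  have hd := (hf.det_pos hu).ne'
  have hB : (firstForm f u).det * (shapeMatrix f u).det = (secondForm f u).det := by
    rw [← Matrix.det_mul, hf.firstForm_mul_shapeMatrix hu]
  have hsymm : firstForm f u 1 0 = firstForm f u 0 1 := form_comm _ _
  -- Gauss' equation is the component along `∂₀ f` of this symmetry of third derivatives.
  have hc : pd 0 (pd 1 (pd 1 f)) u = pd 1 (pd 0 (pd 1 f)) u :=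
    pd_comm ((hf.contDiffOn_pd 1).contDiffAt (hf.isOpen.mem_nhds hu)) 0 1
  have key := congrArg (fun w => form w (pd 0 f u)) hc
  simp only [hf.form_pd_pd_pd hu, Fin.sum_univ_two,
    ← hf.sum_christoffel_mul_firstForm hu] at key
  rw [gaussCurvature, div_eq_iff hd, sub_mul, mul_comm (Matrix.det _), hB]
  simp only [curvatureComp, Matrix.det_fin_two, Fin.sum_univ_two, hsymm,
    hf.secondForm_symm hu 1 0] at key ⊢
  linear_combination key

end IsSurface

/-- An endomorphism of a Euclidean plane which is self-adjoint and has no positive eigenvalue has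
non-positive trace. -/
theorem trace_nonpos_of_eigenvalue_nonpos {g B : Matrix (Fin 2) (Fin 2) ℝ} (hg : g.PosDef)
    (hB : (g * B) 0 1 = (g * B) 1 0)
    (h : ∀ lam, Module.End.HasEigenvalue (Matrix.toLin' B) lam → lam ≤ 0) : B.trace ≤ 0 := by
  have hsymm : g 1 0 = g 0 1 := by simpa using (hg.isHermitian.apply 1 0).symm
  have hdet := hg.det_pos
  have h00 : 0 < g 0 0 := hg.diag_pos
  rw [Matrix.det_fin_two, hsymm] at hdet
  simp only [Matrix.mul_apply, Fin.sum_univ_two, hsymm] at hB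
  -- Self-adjointness makes the discriminant nonnegative: multiplied by `g 0 0` twice, it becomes a
  -- square plus a multiple of `det g`.
  have hdisc : 0 ≤ B.trace ^ 2 - 4 * B.det := by
    rw [Matrix.trace_fin_two, Matrix.det_fin_two]
    have h1 : g 0 0 * ((B 0 0 + B 1 1) ^ 2 - 4 * (B 0 0 * B 1 1 - B 0 1 * B 1 0)) =
        g 0 0 * (B 0 0 - B 1 1) ^ 2 + 4 * g 0 1 * (B 0 0 - B 1 1) * B 1 0 +
          4 * g 1 1 * B 1 0 ^ 2 := by linear_combination 4 * B 1 0 * hB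
    have h2 : g 0 0 * (g 0 0 * (B 0 0 - B 1 1) ^ 2 + 4 * g 0 1 * (B 0 0 - B 1 1) * B 1 0 +
          4 * g 1 1 * B 1 0 ^ 2) = (g 0 0 * (B 0 0 - B 1 1) + 2 * g 0 1 * B 1 0) ^ 2 +
            4 * (g 0 0 * g 1 1 - g 0 1 * g 0 1) * B 1 0 ^ 2 := by ring
    have h3 : 0 ≤ g 0 0 * (g 0 0 * (B 0 0 - B 1 1) ^ 2 + 4 * g 0 1 * (B 0 0 - B 1 1) * B 1 0 +
          4 * g 1 1 * B 1 0 ^ 2) := by rw [h2]; positivity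
    exact nonneg_of_mul_nonneg_right (by rw [h1]; exact nonneg_of_mul_nonneg_right h3 h00) h00
  have hsq := Real.sq_sqrt hdisc
  have hnn := Real.sqrt_nonneg (B.trace ^ 2 - 4 * B.det)
  -- The larger root of the characteristic polynomial: it is at least half the trace, so its sign
  -- bounds the trace.
  set lam := (B.trace + √(B.trace ^ 2 - 4 * B.det)) / 2 with hlam
  have hchar : (B - lam • 1).det = 0 := by
    rw [Matrix.det_fin_two]
    simp only [Matrix.sub_apply, Matrix.smul_apply, Matrix.one_apply_eq, smul_eq_mul, mul_one,
      ne_eq, zero_ne_one, one_ne_zero, not_false_eq_true, Matrix.one_apply_ne, mul_zero, sub_zero]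
    have e1 := Matrix.trace_fin_two B
    have e2 := Matrix.det_fin_two B
    have e3 : lam ^ 2 - B.trace * lam + B.det = 0 := by rw [hlam]; linear_combination hsq / 4
    rw [e1, e2] at e3
    linear_combination e3
  obtain ⟨x, hx0, hx⟩ := Matrix.exists_mulVec_eq_zero_iff.mpr hchar
  have hle : lam ≤ 0 := by
    refine h lam (Module.End.hasEigenvalue_of_hasEigenvector (x := x)
      (Module.End.hasEigenvector_iff.mpr ⟨Module.End.mem_eigenspace_iff.mpr ?_, hx0⟩))
    rw [Matrix.sub_mulVec, Matrix.smul_mulVec, Matrix.one_mulVec, sub_eq_zero] at hx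
    simpa using hx
  rw [hlam] at hle
  linarith

/-- The parallel surface at distance `t` in the future. -/
noncomputable def parallel (f : E2 → V4) (t : ℝ) (u : E2) : V4 :=
  Real.cosh t • f u + Real.sinh t • unitNormal f u

/-- The unit normal field of the parallel surface. -/
noncomputable def parallelNormal (f : E2 → V4) (t : ℝ) (u : E2) : V4 :=
  Real.sinh t • f u + Real.cosh t • unitNormal f u

/-- The differential of the map to the parallel surface in the coordinate frame. -/
noncomputable def parallelMatrix (f : E2 → V4) (t : ℝ) (u : E2) : Matrix (Fin 2) (Fin 2) ℝ :=
  Real.cosh t • 1 - Real.sinh t • shapeMatrix f u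

/-! ### Geometry of the parallel surfaces -/

namespace IsSurface

variable {f : E2 → V4} {U : Set E2} {u : E2}

theorem mono (hf : IsSurface f U) {U' : Set E2} (hU' : IsOpen U') (h : U' ⊆ U) : IsSurface f U' :=
  ⟨hU', hf.smooth.mono h, fun u hu => hf.sphere u (h hu), fun u hu => hf.spacelike u (h hu)⟩

theorem trace_shapeMatrix_nonpos (hf : IsSurface f U) (hu : u ∈ U)
    (h : ∀ lam, IsPrincipalCurvature f u lam → lam ≤ 0) : (shapeMatrix f u).trace ≤ 0 := by
  refine trace_nonpos_of_eigenvalue_nonpos (hf.spacelike u hu) ?_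
    fun lam hlam => h lam ⟨_, hf.isShapeOperator hu, hlam⟩
  rw [hf.firstForm_mul_shapeMatrix hu, hf.secondForm_symm hu]

theorem form_parallel_self (hf : IsSurface f U) (hu : u ∈ U) (t : ℝ) :
    form (parallel f t u) (parallel f t u) = 1 := by
  simp only [parallel, form_add_left, form_add_right, form_smul_left, form_smul_right,
    form_comm (f u) (unitNormal f u), hf.form_normal_position hu, hf.form_normal_self hu,
    hf.sphere u hu]
  linear_combination Real.cosh_sq t

theorem form_parallelNormal_self (hf : IsSurface f U) (hu : u ∈ U) (t : ℝ) :
    form (parallelNormal f t u) (parallelNormal f t u) = -1 := by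
  simp only [parallelNormal, form_add_left, form_add_right, form_smul_left, form_smul_right,
    form_comm (f u) (unitNormal f u), hf.form_normal_position hu, hf.form_normal_self hu,
    hf.sphere u hu]
  linear_combination -Real.cosh_sq t

theorem form_parallelNormal_parallel (hf : IsSurface f U) (hu : u ∈ U) (t : ℝ) :
    form (parallelNormal f t u) (parallel f t u) = 0 := by
  simp only [parallelNormal, parallel, form_add_left, form_add_right, form_smul_left,
    form_smul_right, form_comm (f u) (unitNormal f u), hf.form_normal_position hu,
    hf.form_normal_self hu, hf.sphere u hu]
  ring

theorem form_parallelNormal_pd (hf : IsSurface f U) (hu : u ∈ U) (t : ℝ) (i : Fin 2) :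
    form (parallelNormal f t u) (pd i f u) = 0 := by
  simp only [parallelNormal, form_add_left, form_smul_left, hf.form_pd_self hu,
    hf.form_normal_pd hu]
  ring

theorem form_pd_parallel (hf : IsSurface f U) (hu : u ∈ U) (t : ℝ) (i : Fin 2) :
    form (pd i f u) (parallel f t u) = 0 := by
  rw [form_comm]
  simp only [parallel, form_add_left, form_smul_left, hf.form_pd_self hu, hf.form_normal_pd hu]
  ring

/-- Its product with `η` is `-cosh t < 0`, so it stays in the future cone. -/
theorem parallelNormal_future (hf : IsSurface f U) (hu : u ∈ U) (t : ℝ) :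
    0 < parallelNormal f t u 0 := by
  refine future_of_form_neg (n := unitNormal f u) ?_ (hf.unitNormal_spec hu).2.2.2 ?_ ?_
  · rw [hf.form_normal_self hu]; norm_num
  · rw [hf.form_parallelNormal_self hu]; norm_num
  · rw [parallelNormal, form_add_right, form_smul_right, form_smul_right,
      hf.form_normal_position hu, hf.form_normal_self hu]
    have := Real.cosh_pos t
    linarith

theorem contDiffOn_parallel (hf : IsSurface f U) (t : ℝ) :
    ContDiffOn ℝ (⊤ : ℕ∞) (parallel f t) U :=
  (hf.smooth.const_smul _).add (hf.contDiffOn_unitNormal.const_smul _)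

/-- The coefficients are left free so that one computation covers both the parallel surface and its
normal, where `cosh` and `sinh` are exchanged. -/
theorem pd_lincomb (hf : IsSurface f U) (hu : u ∈ U) (a b : ℝ) (i : Fin 2) :
    pd i (fun v => a • f v + b • unitNormal f v) u =
      ∑ k, (a • 1 - b • shapeMatrix f u) k i • pd k f u := by
  have df := hf.differentiableAt_of_contDiffOn hu hf.smooth
  have dη := hf.differentiableAt_unitNormal hu
  have dc (a : ℝ) : DifferentiableAt ℝ (fun _ : E2 => a) u := differentiableAt_const a
  rw [pd_add ((dc a).fun_smul df) ((dc b).fun_smul dη), pd_smul (dc a) df, pd_smul (dc b) dη,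
    pd_const, pd_const, hf.pd_unitNormal hu]
  simp only [Fin.sum_univ_two, Matrix.sub_apply, Matrix.smul_apply, smul_eq_mul]
  obtain rfl | rfl : i = 0 ∨ i = 1 := by omega
  all_goals
    simp only [Matrix.one_apply_eq, ne_eq, zero_ne_one, one_ne_zero, not_false_eq_true,
      Matrix.one_apply_ne]
    module

variable {A : Matrix (Fin 4) (Fin 4) ℝ} {F : E2 → V4} {t : ℝ}

theorem pd_eq_of_eqOn (hf : IsSurface f U) (hu : u ∈ U) {a b : ℝ}
    (hF : ∀ v ∈ U, F v = A.mulVec (a • f v + b • unitNormal f v)) (i : Fin 2) :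
    pd i F u = ∑ k, (a • 1 - b • shapeMatrix f u) k i • A.mulVec (pd k f u) := by
  have he : F =ᶠ[𝓝 u] fun v => A.mulVecLin.toContinuousLinearMap (a • f v + b • unitNormal f v) := by
    filter_upwards [hf.isOpen.mem_nhds hu] with v hv using hF v hv
  have df := hf.differentiableAt_of_contDiffOn hu hf.smooth
  have dη := hf.differentiableAt_unitNormal hu
  rw [pd_congr he, pd_clm _ ((df.fun_const_smul a).fun_add (dη.fun_const_smul b)),
    hf.pd_lincomb hu]
  simp only [map_sum, map_smul]
  rfl

theorem firstForm_eq_of_eqOn (hf : IsSurface f U) (hA : IsIsometryMatrix A) (hu : u ∈ U)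
    (hF : ∀ v ∈ U, F v = A.mulVec (parallel f t v)) :
    firstForm F u = (parallelMatrix f t u).transpose * firstForm f u * parallelMatrix f t u := by
  ext i j
  rw [firstForm_apply, hf.pd_eq_of_eqOn hu hF, hf.pd_eq_of_eqOn hu hF]
  simp only [Matrix.mul_apply, Fin.sum_univ_two, form_add_left, form_add_right, form_smul_left,
    form_smul_right, hA.form_mulVec, Matrix.transpose_apply, firstForm_apply, parallelMatrix]
  ring

/-- The parallel surfaces are space-like surfaces where the normal flow is an immersion. -/
theorem isSurface_of_eqOn_parallel (hf : IsSurface f U) (hA : IsIsometryMatrix A)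
    (hF : ∀ v ∈ U, F v = A.mulVec (parallel f t v))
    (hd : ∀ v ∈ U, (parallelMatrix f t v).det ≠ 0) : IsSurface F U where
  isOpen := hf.isOpen
  smooth := (A.mulVecLin.toContinuousLinearMap.contDiff.comp_contDiffOn
    (hf.contDiffOn_parallel t)).congr hF
  sphere u hu := by rw [hF u hu, hA.form_mulVec, hf.form_parallel_self hu]
  spacelike u hu := by
    rw [hf.firstForm_eq_of_eqOn hA hu hF, ← Matrix.conjTranspose_eq_transpose_of_trivial]
    exact (hf.spacelike u hu).conjTranspose_mul_mul_same
      (Matrix.mulVec_injective_iff_isUnit.mpr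
        ((Matrix.isUnit_iff_isUnit_det _).mpr (hd u hu).isUnit))

theorem unitNormal_of_eqOn_parallel (hf : IsSurface f U) (hA : IsIsometryMatrix A)
    (hF : ∀ v ∈ U, F v = A.mulVec (parallel f t v))
    (hd : ∀ v ∈ U, (parallelMatrix f t v).det ≠ 0) (hu : u ∈ U) :
    unitNormal F u = A.mulVec (parallelNormal f t u) := by
  refine (hf.isSurface_of_eqOn_parallel hA hF hd).eq_unitNormal hu ⟨?_, fun i => ?_, ?_, ?_⟩
  · rw [hF u hu, hA.form_mulVec, hf.form_parallelNormal_parallel hu]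
  · rw [hf.pd_eq_of_eqOn hu hF, Fin.sum_univ_two, form_add_right, form_smul_right,
      form_smul_right, hA.form_mulVec, hA.form_mulVec, hf.form_parallelNormal_pd hu,
      hf.form_parallelNormal_pd hu]
    ring
  · rw [hA.form_mulVec, hf.form_parallelNormal_self hu]
  · exact hA.future (by rw [hf.form_parallelNormal_self hu]; norm_num)
      (hf.parallelNormal_future hu t)

/-- The shape operator of the parallel surfaces. -/
theorem isShapeOperator_of_eqOn_parallel (hf : IsSurface f U) (hA : IsIsometryMatrix A)
    (hF : ∀ v ∈ U, F v = A.mulVec (parallel f t v))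
    (hd : ∀ v ∈ U, (parallelMatrix f t v).det ≠ 0) (hu : u ∈ U) :
    IsShapeOperator F u ((parallelMatrix f t u)⁻¹ *
      (Real.cosh t • shapeMatrix f u - Real.sinh t • 1)) := by
  intro j
  have hη : ∀ v ∈ U, unitNormal F v =
      A.mulVec (Real.sinh t • f v + Real.cosh t • unitNormal f v) :=
    fun v hv => hf.unitNormal_of_eqOn_parallel hA hF hd hv
  have h1 := hf.pd_eq_of_eqOn hu hη j
  have h2 (i) := hf.pd_eq_of_eqOn hu hF i
  -- The derivative of the normal is already tangent to `dS₃`, so the projection does nothing.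
  have h3 : form (pd j (unitNormal F) u) (F u) = 0 := by
    rw [h1, hF u hu, Fin.sum_univ_two, form_add_left, form_smul_left, form_smul_left,
      hA.form_mulVec, hA.form_mulVec, hf.form_pd_parallel hu, hf.form_pd_parallel hu]
    ring
  rw [tangentProj, h3, zero_smul, sub_zero, h1]
  set B' := (parallelMatrix f t u)⁻¹ * (Real.cosh t • shapeMatrix f u - Real.sinh t • 1) with hB'
  have h4 : parallelMatrix f t u * B' = Real.cosh t • shapeMatrix f u - Real.sinh t • 1 :=
    Matrix.mul_nonsing_inv_cancel_left _ _ (hd u hu).isUnit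
  have h5 (k) := congrFun (congrFun h4 k) j
  simp only [Matrix.mul_apply, Fin.sum_univ_two] at h5
  simp only [h2, Fin.sum_univ_two]
  have e (k) : (Real.sinh t • 1 - Real.cosh t • shapeMatrix f u) k j =
      -(Real.cosh t • shapeMatrix f u - Real.sinh t • 1) k j := by
    rw [← Matrix.neg_apply, neg_sub]
  rw [e, e, ← h5, ← h5]
  simp only [parallelMatrix]
  module

theorem det_parallelMatrix (f : E2 → V4) (t : ℝ) (u : E2) :
    (parallelMatrix f t u).det = Real.cosh t ^ 2 -
      Real.cosh t * Real.sinh t * (shapeMatrix f u).trace +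
      Real.sinh t ^ 2 * (shapeMatrix f u).det := by
  simp [parallelMatrix, Matrix.det_fin_two, Matrix.trace_fin_two]
  ring

/-- A surface whose shape operator has determinant `coth² t` has a parallel surface of constant mean
curvature at distance `t`. -/
theorem hasMeanCurvatureAt_of_eqOn_parallel (hf : IsSurface f U) (hA : IsIsometryMatrix A)
    (hF : ∀ v ∈ U, F v = A.mulVec (parallel f t v))
    (hd : ∀ v ∈ U, (parallelMatrix f t v).det ≠ 0) (hu : u ∈ U) (ht : 0 < t)
    (hdet : Real.sinh t ^ 2 * (shapeMatrix f u).det = Real.cosh t ^ 2) :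
    HasMeanCurvatureAt F u
      (-(Real.cosh t ^ 2 + Real.sinh t ^ 2) / (2 * (Real.cosh t * Real.sinh t))) := by
  refine ⟨_, hf.isShapeOperator_of_eqOn_parallel hA hF hd hu, ?_⟩
  have hs := Real.sinh_pos_iff.mpr ht
  have hc := Real.cosh_pos t
  have hd' := hd u hu
  -- Writing the inverse as adjugate over determinant gives the trace of the new shape operator
  -- without denominators.
  have htr : ((parallelMatrix f t u)⁻¹ *
      (Real.cosh t • shapeMatrix f u - Real.sinh t • 1)).trace * (parallelMatrix f t u).det =
      (Real.cosh t ^ 2 + Real.sinh t ^ 2) * (shapeMatrix f u).trace -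
        2 * Real.cosh t * Real.sinh t * (1 + (shapeMatrix f u).det) := by
    rw [Matrix.inv_def, Ring.inverse_eq_inv', Matrix.smul_mul, Matrix.trace_smul, smul_eq_mul,
      mul_right_comm, inv_mul_cancel₀ hd', one_mul]
    simp [parallelMatrix, Matrix.adjugate_fin_two, Matrix.trace_fin_two, Matrix.vecMul,
      dotProduct, Fin.sum_univ_two, Matrix.det_fin_two]
    ring
  have h1 := det_parallelMatrix f t u
  refine mul_right_cancel₀ hd' ?_
  rw [div_mul_eq_mul_div, htr, h1]
  field_simp
  -- The terms in `tr B` have cancelled; what remains factors as `(cosh² t - sinh² t)(cosh² t -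
  -- sinh² t det B)`.
  linear_combination (-Real.cosh t ^ 2 + Real.sinh t ^ 2) * hdet

theorem fderiv_injective (hf : IsSurface f U) (hu : u ∈ U) :
    Function.Injective (fderiv ℝ f u) := by
  rw [injective_iff_map_eq_zero]
  intro x hx
  have hsum : fderiv ℝ f u x = x 0 • pd 0 f u + x 1 • pd 1 f u := by
    have : x = x 0 • Pi.single 0 1 + x 1 • Pi.single 1 1 := by
      ext i; fin_cases i <;> simp
    conv_lhs => rw [this]
    simp [pd]
  rw [hx] at hsum
  refine Matrix.eq_zero_of_mulVec_eq_zero (hf.det_pos hu).ne' ?_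
  ext i
  have h := congrArg (form (pd i f u)) hsum
  have h0 : form (pd i f u) 0 = 0 := by simp [form]
  rw [h0, form_add_right, form_smul_right, form_smul_right] at h
  simp only [Matrix.mulVec, dotProduct, Fin.sum_univ_two, firstForm_apply, Pi.zero_apply]
  linarith

/-- Parametrized surfaces are locally embedded. -/
theorem exists_isEmbedding (hf : IsSurface f U) (hu : u ∈ U) :
    ∃ V ∈ 𝓝 u, ∀ V' ⊆ V ∩ U, IsEmbedding (fun v : V' => f v) := by
  have hs : HasStrictFDerivAt f (fderiv ℝ f u) u :=
    (hf.contDiffAt hu).hasStrictFDerivAt (by simp)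
  -- With a left inverse `L` of the differential, `L ∘ f` has identity derivative and is a local
  -- homeomorphism by the inverse function theorem; then `f` itself is an embedding there.
  obtain ⟨L, hL⟩ := LinearMap.exists_leftInverse_of_injective (fderiv ℝ f u).toLinearMap
    (LinearMap.ker_eq_bot.mpr (hf.fderiv_injective hu))
  let L' : V4 →L[ℝ] E2 := L.toContinuousLinearMap
  have hs' : HasStrictFDerivAt (fun v => L' (f v))
      ((ContinuousLinearEquiv.refl ℝ E2 : E2 ≃L[ℝ] E2) : E2 →L[ℝ] E2) u := by
    have h := L'.hasStrictFDerivAt.comp u hs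
    have he : L'.comp (fderiv ℝ f u) = (ContinuousLinearEquiv.refl ℝ E2 : E2 →L[ℝ] E2) := by
      ext1 x
      exact LinearMap.congr_fun hL x
    rwa [he] at h
  let e := hs'.toOpenPartialHomeomorph _
  refine ⟨e.source, e.open_source.mem_nhds hs'.mem_toOpenPartialHomeomorph_source,
    fun V' hV' => ?_⟩
  have h1 : IsEmbedding (L' ∘ fun v : V' => f v) :=
    e.isOpenEmbedding_restrict.isEmbedding.comp
      (IsEmbedding.inclusion (hV'.trans inter_subset_left))
  exact IsEmbedding.of_comp
    (continuousOn_iff_continuous_domRestrict.mp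
      (hf.smooth.continuousOn.mono (hV'.trans inter_subset_right))) L'.continuous h1

end IsSurface

/-! ### Geodesics of `dS₃` -/

theorem eq_of_hasDerivWithinAt_zero {W : Type*} [NormedAddCommGroup W] [NormedSpace ℝ W]
    {J : Set ℝ} (hJ : Convex ℝ J) {x : ℝ → W} (hx : ∀ r ∈ J, HasDerivWithinAt x 0 J r) {r s : ℝ}
    (hr : r ∈ J) (hs : s ∈ J) : x r = x s := by
  have := hJ.norm_image_sub_le_of_norm_hasDerivWithin_le (C := 0) hx (by simp) hs hr
  rw [zero_mul] at this
  exact sub_eq_zero.mp (norm_le_zero_iff.mp this)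

/-- The time-like geodesics of `dS₃` parametrized by proper time. -/
theorem geodesic_eq {J : Set ℝ} (hJ : Convex ℝ J) (hJ' : UniqueDiffOn ℝ J) {x w acc : ℝ → V4}
    (hx : ∀ r ∈ J, HasDerivWithinAt x (w r) J r) (hw : ∀ r ∈ J, HasDerivWithinAt w (acc r) J r)
    (hsph : ∀ r ∈ J, form (x r) (x r) = 1) (hgeo : ∀ r ∈ J, tangentProj (x r) (acc r) = 0)
    {s : ℝ} (hs : s ∈ J) (hws : form (w s) (w s) = -1) {r : ℝ} (hr : r ∈ J) :
    x r = Real.cosh (r - s) • x s + Real.sinh (r - s) • w s ∧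
      w r = Real.sinh (r - s) • x s + Real.cosh (r - s) • w s := by
  -- The acceleration is proportional to the position. Differentiating `⟨x, x⟩ = 1` twice and using
  -- `⟨w, w⟩ = -1` turns the geodesic equation into `x'' = x`.
  have hacc : ∀ r ∈ J, acc r = form (acc r) (x r) • x r := fun r hr => sub_eq_zero.mp (hgeo r hr)
  have hxw : ∀ r ∈ J, form (x r) (w r) = 0 := by
    intro r hr
    have h1 : HasDerivWithinAt (fun r => form (x r) (x r))
        (form (x r) (w r) + form (w r) (x r)) J r :=
      formL.hasDerivWithinAt_of_bilinear (hx r hr) (hx r hr)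
    have h2 : HasDerivWithinAt (fun r => form (x r) (x r)) 0 J r :=
      (hasDerivWithinAt_const r J (1 : ℝ)).congr hsph (hsph r hr)
    have h3 := (hJ' r hr).eq_deriv _ h1 h2
    rw [form_comm (w r)] at h3
    linarith
  have hxa : ∀ r ∈ J, form (acc r) (x r) = -form (w r) (w r) := by
    intro r hr
    have h1 : HasDerivWithinAt (fun r => form (x r) (w r))
        (form (x r) (acc r) + form (w r) (w r)) J r :=
      formL.hasDerivWithinAt_of_bilinear (hx r hr) (hw r hr)
    have h2 : HasDerivWithinAt (fun r => form (x r) (w r)) 0 J r :=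
      (hasDerivWithinAt_const r J (0 : ℝ)).congr hxw (hxw r hr)
    have h3 := (hJ' r hr).eq_deriv _ h1 h2
    rw [form_comm (acc r)]
    linarith
  have hww : ∀ r ∈ J, form (w r) (w r) = -1 := by
    intro r hr
    rw [← hws]
    refine eq_of_hasDerivWithinAt_zero (x := fun r => form (w r) (w r)) hJ (fun r hr => ?_) hr hs
    have h1 : HasDerivWithinAt (fun r => form (w r) (w r))
        (form (w r) (acc r) + form (acc r) (w r)) J r :=
      formL.hasDerivWithinAt_of_bilinear (hw r hr) (hw r hr)
    rwa [hacc r hr, form_smul_left, form_smul_right, form_comm (w r), hxw r hr, mul_zero,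
      add_zero] at h1
  have hw' : ∀ r ∈ J, HasDerivWithinAt w (x r) J r := by
    intro r hr
    have h1 := hw r hr
    rwa [hacc r hr, hxa r hr, hww r hr, neg_neg, one_smul] at h1
  have hch (r : ℝ) : HasDerivWithinAt (fun r => Real.cosh (r - s)) (Real.sinh (r - s)) J r := by
    simpa using ((hasDerivAt_id r).sub_const s).cosh.hasDerivWithinAt
  have hsh (r : ℝ) : HasDerivWithinAt (fun r => Real.sinh (r - s)) (Real.cosh (r - s)) J r := by
    simpa using ((hasDerivAt_id r).sub_const s).sinh.hasDerivWithinAt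
  -- Undoing the hyperbolic rotation gives two conserved quantities, equal to the initial data at `r
  -- = s`; rotating back yields the solution.
  have e1 : Real.cosh (r - s) • x r - Real.sinh (r - s) • w r = x s := by
    have h := eq_of_hasDerivWithinAt_zero (x := fun r => Real.cosh (r - s) • x r -
      Real.sinh (r - s) • w r) hJ (fun r hr => ?_) hr hs
    · simpa using h
    · convert ((hch r).fun_smul (hx r hr)).fun_sub ((hsh r).fun_smul (hw' r hr)) using 1
      abel
  have e2 : Real.cosh (r - s) • w r - Real.sinh (r - s) • x r = w s := by
    have h := eq_of_hasDerivWithinAt_zero (x := fun r => Real.cosh (r - s) • w r -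
      Real.sinh (r - s) • x r) hJ (fun r hr => ?_) hr hs
    · simpa using h
    · convert ((hch r).fun_smul (hw' r hr)).fun_sub ((hsh r).fun_smul (hx r hr)) using 1
      abel
  have hcs := Real.cosh_sq (r - s)
  constructor
  · rw [← e1, ← e2]
    have : x r = (Real.cosh (r - s) ^ 2 - Real.sinh (r - s) ^ 2) • x r := by rw [hcs]; module
    conv_lhs => rw [this]
    module
  · rw [← e1, ← e2]
    have : w r = (Real.cosh (r - s) ^ 2 - Real.sinh (r - s) ^ 2) • w r := by rw [hcs]; module
    conv_lhs => rw [this]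
    module

/-- The addition formulas: the normal geodesic can be restarted at time `s` from the parallel
surface and its normal, as needed to continue across charts. -/
theorem parallel_eq (f : E2 → V4) (r s : ℝ) (u : E2) :
    parallel f r u = Real.cosh (r - s) • parallel f s u +
      Real.sinh (r - s) • parallelNormal f s u := by
  have h1 := Real.cosh_add (r - s) s
  have h2 := Real.sinh_add (r - s) s
  rw [sub_add_cancel] at h1 h2
  simp only [parallel, parallelNormal, h1, h2]
  module

theorem parallelNormal_eq (f : E2 → V4) (r s : ℝ) (u : E2) :
    parallelNormal f r u = Real.sinh (r - s) • parallel f s u +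
      Real.cosh (r - s) • parallelNormal f s u := by
  have h1 := Real.cosh_add (r - s) s
  have h2 := Real.sinh_add (r - s) s
  rw [sub_add_cancel] at h1 h2
  simp only [parallel, parallelNormal, h1, h2]
  module

/-! ### The normal flow read in charts -/

namespace ParticleManifold

variable {M : Type*} [TopologicalSpace M] {X : ParticleManifold M}

theorem form_read {A : Type*} (c : OpenPartialHomeomorph M DS) (σ : A → M) (a : A) :
    form (read c σ a) (read c σ a) = 1 := (c (σ a)).2

/-- A geodesic read in a chart, with its velocity as a derivative. -/
theorem IsGeodesicOn.exists_acc {γ : ℝ → M} {I : Set ℝ} (hγ : X.IsGeodesicOn γ I)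
    (hI : UniqueDiffOn ℝ I) {c : OpenPartialHomeomorph M DS} (hc : c ∈ X.charts) {s : ℝ}
    (hs : s ∈ I) (hsc : γ s ∈ c.source) : ∃ a,
      HasDerivWithinAt (read c γ) (derivWithin (read c γ) I s) I s ∧
      HasDerivWithinAt (derivWithin (read c γ) I) a I s ∧ tangentProj (read c γ s) a = 0 := by
  obtain ⟨vel, acc, h⟩ := hγ.2.2 s hs c hc hsc
  have hs0 := h.self_of_nhdsWithin hs
  have he : derivWithin (read c γ) I =ᶠ[𝓝[I] s] vel := by
    filter_upwards [h, self_mem_nhdsWithin] with r hr hrI using hr.1.derivWithin (hI r hrI)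
  refine ⟨acc s, hs0.1.differentiableWithinAt.hasDerivWithinAt, ?_, hs0.2.2⟩
  exact hs0.2.1.congr_of_eventuallyEq he (he.self_of_nhdsWithin hs)

/-- Near `u`, the flow at time `s`, read in the chart `c'`, is the parallel surface of `f` moved by
the isometry `A`, to first order in time. -/
def FlowMatches (ψ : ℝ → M → M) (σ : E2 → M) (f : E2 → V4) (T : ℝ) (u : E2)
    (c' : OpenPartialHomeomorph M DS) (A : Matrix (Fin 4) (Fin 4) ℝ) (s : ℝ) : Prop :=
  ∀ᶠ v in 𝓝 u, read c' (fun t => ψ t (σ v)) s = A.mulVec (parallel f s v) ∧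
    HasDerivWithinAt (read c' fun t => ψ t (σ v)) (A.mulVec (parallelNormal f s v)) (Icc 0 T) s

section Flow

variable {S : Set M} {T : ℝ} {ψ : ℝ → M → M} {c : OpenPartialHomeomorph M DS} {U : Set E2}
  {σ : E2 → M} {u : E2}

theorem IsPatchOf.mem (hP : X.IsPatchOf S c U σ) {v : E2} (hv : v ∈ U) : σ v ∈ S ∩ X.reg := by
  obtain ⟨O, -, hO⟩ := hP.image
  have h : σ v ∈ S ∩ O := hO ▸ mem_image_of_mem σ hv
  exact ⟨h.1, c, hP.chart, hP.mapsTo hv⟩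

theorem IsPatchOf.isSurface (hP : X.IsPatchOf S c U σ) : IsSurface (read c σ) U :=
  ⟨hP.isOpen, hP.smooth, fun u _ => form_read c σ u, hP.spacelike⟩

theorem IsPatchOf.continuousOn (hP : X.IsPatchOf S c U σ) : ContinuousOn σ U :=
  continuousOn_iff_continuous_domRestrict.mpr hP.embedding.continuous

theorem IsNormalFlow.continuousOn_patch (hψ : X.IsNormalFlow S T ψ) (hP : X.IsPatchOf S c U σ) :
    ContinuousOn (fun p : ℝ × E2 => ψ p.1 (σ p.2)) (Icc 0 T ×ˢ U) := by
  refine hψ.continuousOn.comp (f := fun p : ℝ × E2 => (p.1, σ p.2)) ?_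
    fun p hp => ⟨hp.1, hP.mem hp.2⟩
  exact continuousOn_fst.prodMk (hP.continuousOn.comp continuousOn_snd fun p hp => hp.2)

/-- Joint continuity in time and base point lets one chart serve all nearby geodesics over a common
time interval. -/
theorem IsNormalFlow.tendsto_patch (hψ : X.IsNormalFlow S T ψ) (hP : X.IsPatchOf S c U σ)
    (hu : u ∈ U) {s : ℝ} (hs : s ∈ Icc 0 T) :
    Tendsto (fun p : ℝ × E2 => ψ p.1 (σ p.2)) (𝓝[Icc 0 T] s ×ˢ 𝓝 u) (𝓝 (ψ s (σ u))) := by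
  have h := hψ.continuousOn_patch hP (s, u) ⟨hs, hu⟩
  rwa [ContinuousWithinAt, nhdsWithin_prod_eq, hP.isOpen.nhdsWithin_eq hu] at h

theorem IsNormalFlow.flowMatches_zero (hψ : X.IsNormalFlow S T ψ) (hP : X.IsPatchOf S c U σ)
    (hu : u ∈ U) : FlowMatches ψ σ (read c σ) T u c 1 0 := by
  filter_upwards [hP.isOpen.mem_nhds hu] with v hv
  constructor
  · simp [read, parallel, hψ.start _ (hP.mem hv)]
  · simpa [parallelNormal] using hψ.normal c U σ hP v hv

/-- Near the point the transition map is a single linear isometry; it applies to positions at times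
near `s`, hence to velocities too. -/
theorem IsNormalFlow.flowMatches_change (hψ : X.IsNormalFlow S T ψ) (hP : X.IsPatchOf S c U σ)
    (hu : u ∈ U) {s : ℝ} (hs : s ∈ Icc 0 T) {c₁ c₂ : OpenPartialHomeomorph M DS}
    (h₁ : c₁ ∈ X.charts) (h₂ : c₂ ∈ X.charts) (hs₁ : ψ s (σ u) ∈ c₁.source)
    (hs₂ : ψ s (σ u) ∈ c₂.source) {A : Matrix (Fin 4) (Fin 4) ℝ} (hA : IsIsometryMatrix A)
    (h : FlowMatches ψ σ (read c σ) T u c₁ A s) :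
    ∃ A', IsIsometryMatrix A' ∧ FlowMatches ψ σ (read c σ) T u c₂ A' s := by
  obtain ⟨A₀, hA₀, he⟩ := X.compatible c₁ h₁ c₂ h₂ _ ⟨hs₁, hs₂⟩
  refine ⟨A₀ * A, hA₀.mul hA, ?_⟩
  have h1 := (hψ.tendsto_patch hP hu hs).eventually he
  -- The quantifiers are reordered to get, for each `v` near `u`, the identity at all times near
  -- `s`, as differentiation in time requires.
  rw [eventually_swap_iff] at h1
  filter_upwards [h, h1.curry] with v hv hv'
  have e : read c₂ (fun t => ψ t (σ v)) =ᶠ[𝓝[Icc 0 T] s]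
      fun t => A₀.mulVecLin.toContinuousLinearMap (read c₁ (fun t => ψ t (σ v)) t) := hv'
  have e0 := e.self_of_nhdsWithin hs
  constructor
  · rw [e0, ← Matrix.mulVec_mulVec, ← hv.1]
    rfl
  · rw [← Matrix.mulVec_mulVec]
    exact ((A₀.mulVecLin.toContinuousLinearMap.hasFDerivAt.comp_hasDerivWithinAt s
      hv.2).congr_of_eventuallyEq e e0)

/-- Within one chart, position and velocity at a single time determine the geodesic. The radius `δ`
depends neither on `s` nor on `A`, so the match passes between any two times near `t₀`, in both
directions. -/
theorem IsNormalFlow.flowMatches_propagate (hψ : X.IsNormalFlow S T ψ)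
    (hP : X.IsPatchOf S c U σ) (hu : u ∈ U) (hT : 0 < T) {t₀ : ℝ} (ht₀ : t₀ ∈ Icc 0 T)
    {c' : OpenPartialHomeomorph M DS} (hc' : c' ∈ X.charts) (hmem : ψ t₀ (σ u) ∈ c'.source) :
    ∃ δ > 0, ∀ s ∈ Metric.ball t₀ δ ∩ Icc 0 T, ψ s (σ u) ∈ c'.source ∧
      ∀ A, IsIsometryMatrix A → FlowMatches ψ σ (read c σ) T u c' A s →
        ∀ r ∈ Metric.ball t₀ δ ∩ Icc 0 T, FlowMatches ψ σ (read c σ) T u c' A r := by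
  have h1 := (hψ.tendsto_patch hP hu ht₀).eventually (c'.open_source.mem_nhds hmem)
  obtain ⟨a, ha, b, hb, hab⟩ := mem_prod_iff.mp h1
  obtain ⟨δ, hδ, hδa⟩ := Metric.mem_nhdsWithin_iff.mp ha
  have hI : UniqueDiffOn ℝ (Icc 0 T) := uniqueDiffOn_Icc hT
  have hJ : Convex ℝ (Metric.ball t₀ δ ∩ Icc 0 T) := (convex_ball t₀ δ).inter (convex_Icc 0 T)
  have hJ' : UniqueDiffOn ℝ (Metric.ball t₀ δ ∩ Icc 0 T) := by
    rw [inter_comm]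
    exact hI.inter Metric.isOpen_ball
  refine ⟨δ, hδ, fun s hs => ⟨hab (mk_mem_prod (hδa hs) (mem_of_mem_nhds hb)), ?_⟩⟩
  intro A hA h r hr
  filter_upwards [h, hb, hP.isOpen.mem_nhds hu] with v hv hvb hvU
  have hsrc : ∀ r ∈ Metric.ball t₀ δ ∩ Icc 0 T, ψ r (σ v) ∈ c'.source :=
    fun r hr => hab (mk_mem_prod (hδa hr) hvb)
  have hacc (r : ℝ) (hr : r ∈ Metric.ball t₀ δ ∩ Icc 0 T) :=
    (hψ.geodesic _ (hP.mem hvU)).exists_acc hI hc' hr.2 (hsrc r hr)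
  choose! acc hx hw hgeo using hacc
  have hws : derivWithin (read c' fun t => ψ t (σ v)) (Icc 0 T) s =
      A.mulVec (parallelNormal (read c σ) s v) := hv.2.derivWithin (hI s hs.2)
  have key := geodesic_eq hJ hJ' (fun r hr => (hx r hr).mono inter_subset_right)
    (fun r hr => (hw r hr).mono inter_subset_right) (fun r _ => form_read c' _ r) hgeo hs
    (by rw [hws, hA.form_mulVec, hP.isSurface.form_parallelNormal_self hvU]) hr
  rw [hv.1, hws, ← Matrix.mulVec_smul, ← Matrix.mulVec_smul, ← Matrix.mulVec_smul,
    ← Matrix.mulVec_smul, ← Matrix.mulVec_add, ← Matrix.mulVec_add, ← parallel_eq,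
    ← parallelNormal_eq] at key
  refine ⟨key.1, ?_⟩
  rw [← key.2]
  exact hx r hr

/-- In any chart, the normal flow leads to a parallel surface moved by an isometry. -/
theorem IsNormalFlow.exists_flowMatches (hψ : X.IsNormalFlow S T ψ)
    (hP : X.IsPatchOf S c U σ) (hu : u ∈ U) (hT : 0 < T) {t : ℝ} (ht : t ∈ Icc 0 T)
    {c' : OpenPartialHomeomorph M DS} (hc' : c' ∈ X.charts) (hmem : ψ t (σ u) ∈ c'.source) :
    ∃ A, IsIsometryMatrix A ∧ FlowMatches ψ σ (read c σ) T u c' A t := by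
  -- The chart and the isometry are quantified away, since both may change along the geodesic.
  let Q : ℝ → Prop := fun s => ∃ c₁ ∈ X.charts, ψ s (σ u) ∈ c₁.source ∧
    ∃ A, IsIsometryMatrix A ∧ FlowMatches ψ σ (read c σ) T u c₁ A s
  have h0 : Q 0 := by
    refine ⟨c, hP.chart, ?_, 1, isIsometryMatrix_one, hψ.flowMatches_zero hP hu⟩
    rw [hψ.start _ (hP.mem hu)]
    exact hP.mapsTo hu
  have hQ : Q 0 → Q t := by
    -- Connectedness of `[0, T]` applied to the transitive relation "`Q x` implies `Q y`", which has
    -- only to be checked locally, both ways.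
    refine isPreconnected_Icc.induction₂' (s := Icc 0 T) (fun x y => Q x → Q y) ?_
      (fun x y z _ _ _ h h' => h' ∘ h) ⟨le_rfl, hT.le⟩ ht
    intro t₀ ht₀
    obtain ⟨c₂, hc₂, hmem₂⟩ := (hψ.geodesic _ (hP.mem hu)).2.1 ht₀
    obtain ⟨δ, hδ, hprop⟩ := hψ.flowMatches_propagate hP hu hT ht₀ hc₂ hmem₂
    have hb : Metric.ball t₀ δ ∩ Icc 0 T ∈ 𝓝[Icc 0 T] t₀ :=
      inter_mem (mem_nhdsWithin_of_mem_nhds (Metric.ball_mem_nhds t₀ hδ)) self_mem_nhdsWithin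
    have move : ∀ s ∈ Metric.ball t₀ δ ∩ Icc 0 T, ∀ r ∈ Metric.ball t₀ δ ∩ Icc 0 T,
        Q s → Q r := by
      rintro s hs r hr ⟨c₁, hc₁, hmem₁, A, hA, h⟩
      obtain ⟨A', hA', h'⟩ :=
        hψ.flowMatches_change hP hu hs.2 hc₁ hc₂ hmem₁ (hprop s hs).1 hA h
      exact ⟨c₂, hc₂, (hprop r hr).1, A', hA', (hprop s hs).2 A' hA' h' r hr⟩
    have hmt : t₀ ∈ Metric.ball t₀ δ ∩ Icc 0 T := ⟨Metric.mem_ball_self hδ, ht₀⟩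
    filter_upwards [hb] with s hs using ⟨move t₀ hmt s hs, move s hs t₀ hmt⟩
  obtain ⟨c₁, hc₁, hmem₁, A, hA, h⟩ := hQ h0
  exact hψ.flowMatches_change hP hu ht hc₁ hc' hmem₁ hmem hA h

/-- A map into the domain of a chart is an embedding if it is one in the chart. -/
theorem isEmbedding_of_read {V : Set E2} {F : E2 → M} (hF : ContinuousOn F V)
    (hmaps : MapsTo F V c.source) (h : IsEmbedding fun v : V => read c F v) :
    IsEmbedding fun v : V => F v := by
  let F' : V → c.source := fun v => ⟨F v, hmaps v.2⟩
  have hF' : Continuous F' :=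
    Continuous.subtype_mk (continuousOn_iff_continuous_domRestrict.mp hF) _
  have hg : Continuous fun x : c.source => (c x).1 :=
    continuous_subtype_val.comp (continuousOn_iff_continuous_domRestrict.mp c.continuousOn)
  exact IsEmbedding.subtypeVal.comp (IsEmbedding.of_comp hF' hg h)

theorem IsNormalFlow.exists_patch (hψ : X.IsNormalFlow S T ψ) (hT : 0 < T)
    (hP : X.IsPatchOf S c U σ) (htr : ∀ v ∈ U, (shapeMatrix (read c σ) v).trace ≤ 0)
    (hdet : ∀ v ∈ U, Real.sinh T ^ 2 * (shapeMatrix (read c σ) v).det = Real.cosh T ^ 2)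
    (hu : u ∈ U) {c' : OpenPartialHomeomorph M DS} (hc' : c' ∈ X.charts)
    (hmem : ψ T (σ u) ∈ c'.source) :
    ∃ U' ⊆ U, u ∈ U' ∧ X.IsSpacelikePatch c' U' (ψ T ∘ σ) ∧
      ∀ v ∈ U', HasMeanCurvatureAt (read c' (ψ T ∘ σ)) v
        (-(Real.cosh T ^ 2 + Real.sinh T ^ 2) / (2 * (Real.cosh T * Real.sinh T))) := by
  have hTI : T ∈ Icc 0 T := ⟨hT.le, le_rfl⟩
  obtain ⟨A, hA, hmatch⟩ := hψ.exists_flowMatches hP hu hT hTI hc' hmem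
  have hcont : ContinuousOn (ψ T ∘ σ) U :=
    (hψ.continuousOn_patch hP).comp (f := fun v => (T, v))
      (continuousOn_const.prodMk continuousOn_id) fun v hv => ⟨hTI, hv⟩
  have hsrc : ∀ᶠ v in 𝓝 u, ψ T (σ v) ∈ c'.source :=
    (hcont.continuousAt (hP.isOpen.mem_nhds hu)).eventually (c'.open_source.mem_nhds hmem)
  have hev : ∀ᶠ v in 𝓝 u, v ∈ U ∧ ψ T (σ v) ∈ c'.source ∧
      read c' (ψ T ∘ σ) v = A.mulVec (parallel (read c σ) T v) := by
    filter_upwards [hP.isOpen.mem_nhds hu, hsrc, hmatch] with v h1 h2 h3 using ⟨h1, h2, h3.1⟩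
  obtain ⟨U₀, hU₀, hU₀o, huU₀⟩ := eventually_nhds_iff.mp hev
  have hf : IsSurface (read c σ) U₀ := hP.isSurface.mono hU₀o fun v hv => (hU₀ v hv).1
  have hF : ∀ v ∈ U₀, read c' (ψ T ∘ σ) v = A.mulVec (parallel (read c σ) T v) :=
    fun v hv => (hU₀ v hv).2.2
  -- The determinant is `2 cosh² T - cosh T sinh T tr B`, positive because the trace is nonpositive.
  have hd : ∀ v ∈ U₀, (parallelMatrix (read c σ) T v).det ≠ 0 := by
    intro v hv
    rw [IsSurface.det_parallelMatrix, hdet v (hU₀ v hv).1]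
    have h1 := htr v (hU₀ v hv).1
    have h2 := mul_pos (Real.cosh_pos T) (Real.sinh_pos_iff.mpr hT)
    have h3 := pow_pos (Real.cosh_pos T) 2
    have h4 := mul_nonneg h2.le (neg_nonneg.mpr h1)
    linarith
  have hG := hf.isSurface_of_eqOn_parallel hA hF hd
  obtain ⟨V, hV, hemb⟩ := hG.exists_isEmbedding huU₀
  have hsub : U₀ ∩ interior V ⊆ U₀ := inter_subset_left
  have hG' := hG.mono (hU₀o.inter isOpen_interior) hsub
  refine ⟨U₀ ∩ interior V, fun v hv => (hU₀ v hv.1).1, ⟨huU₀, mem_interior_iff_mem_nhds.mpr hV⟩,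
    ⟨hc', hG'.isOpen, fun v hv => (hU₀ v hv.1).2.1, hG'.smooth, hG'.spacelike, ?_⟩, fun v hv =>
      hf.hasMeanCurvatureAt_of_eqOn_parallel hA hF hd hv.1 hT (hdet v (hU₀ v hv.1).1)⟩
  exact isEmbedding_of_read (hcont.mono fun v hv => (hU₀ v hv.1).1)
    (fun v hv => (hU₀ v hv.1).2.1) (hemb _ fun v hv => ⟨interior_subset hv.2, hv.1⟩)

end Flow

end ParticleManifold

end DeSitter

/-! ### The theorem, with the values of the constants -/

theorem mainTheorem5 {M : Type*} [TopologicalSpace M] [T2Space M] [SecondCountableTopology M]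
    [ConnectedSpace M] (X : DeSitter.ParticleManifold M) (hX : X.IsCGHM)
    (S : Set M) (hS : X.IsSpacelikeSurface S) (horth : X.IsOrthogonal S)
    (hconv : X.IsFutureConvex S) (K : ℝ) (hK : K < 0) (hgauss : X.HasConstantGaussCurvature S K)
    (ψ : ℝ → M → M) (hψ : X.IsNormalFlow S (Real.artanh (Real.sqrt (1 / (1 - K)))) ψ) :
    X.ImageHasConstantMeanCurvature S (ψ (Real.artanh (Real.sqrt (1 / (1 - K)))))
      ((K - 2) / (2 * Real.sqrt (1 - K))) := by
  have hK1 : 0 < 1 - K := by linarith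
  have hr : 0 < √(1 - K) := Real.sqrt_pos.mpr hK1
  have hr2 : √(1 - K) ^ 2 = 1 - K := Real.sq_sqrt hK1.le
  have hr1 : 1 < √(1 - K) := by
    rw [Real.lt_sqrt zero_le_one]
    linarith
  have hτ : √(1 / (1 - K)) = 1 / √(1 - K) := by rw [Real.sqrt_div zero_le_one, Real.sqrt_one]
  have hτ1 : √(1 / (1 - K)) ∈ Ioo (0 : ℝ) 1 := by
    rw [hτ]
    exact ⟨by positivity, by rwa [div_lt_one hr]⟩
  have hT := Real.artanh_pos hτ1
  have htanh := Real.tanh_artanh (x := √(1 / (1 - K))) ⟨by linarith [hτ1.1], hτ1.2⟩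
  set T := Real.artanh √(1 / (1 - K))
  have hs := Real.sinh_pos_iff.mpr hT
  -- This is `tanh T = 1 / √(1 - K)`, the choice of distance for which `coth² T = 1 - K`.
  have hcs : Real.cosh T = √(1 - K) * Real.sinh T := by
    rw [Real.tanh_eq_sinh_div_cosh, hτ, div_eq_div_iff (Real.cosh_pos T).ne' hr.ne'] at htanh
    linarith
  refine ⟨fun x hx => (hψ.geodesic x hx).2.1 ⟨hT.le, le_rfl⟩, ?_⟩
  intro c U σ hP u hu c' hc' hmem
  have hf := hP.isSurface
  have hH : (K - 2) / (2 * √(1 - K)) =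
      -(Real.cosh T ^ 2 + Real.sinh T ^ 2) / (2 * (Real.cosh T * Real.sinh T)) := by
    rw [hcs, div_eq_div_iff (by positivity) (by positivity)]
    linear_combination (2 * √(1 - K) * Real.sinh T ^ 2) * hr2
  rw [hH]
  refine hψ.exists_patch hT hP (fun v hv => hf.trace_shapeMatrix_nonpos hv (hconv c U σ hP v hv))
    (fun v hv => ?_) hu hc' hmem
  have h1 := hgauss c U σ hP v hv
  rw [hf.gaussCurvature_eq hv] at h1
  rw [hcs, mul_pow, hr2]
  -- Gauss' equation gives `det B = 1 - K`, hence `sinh² T det B = cosh² T`.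
  linear_combination -Real.sinh T ^ 2 * h1
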